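/- Let $N\ge 1$ and let $G=T_1\times T_2\times\cdots\times T_N$ be the Cartesian product of trees $T_1,\dots,T_N$, where each $T_i$ is regular of some (finite) degree $k_i\ge 3$; that is, two vertices $x=(x_i)_{i=1}^N$ and $y=(y_i)_{i=1}^N$ of $G$ are adjacent if and only if $x_i$ and $y_i$ are adjacent in $T_i$ for some $i$ and $x_j=y_j$ for all $j\ne i$. Consider Bernoulli bond percolation on $G$ with retention probability $p\in[0,1]$: each edge of $G$ is open independently with probability $p$, and clusters are the connected components of the subgraph spanned by the open edges. Let $$p_c(G)=\inf\{p\in[0,1]:\text{ there is almost surely an infinite cluster}\},$$ $$p_u(G)=\inf\{p\in[0,1]:\text{ there is almost surely a unique infinite cluster}\}.$$ Then $p_c(G)<p_u(G)$. Moreover, $$p_u(G)-p_c(G)\ \ge\ \frac{1-p_c(G)}{2\sum_{i=1}^N\sqrt{k_i-1}}\ \prod_{i=1}^N\frac{(\sqrt{k_i-1}-1)^2}{k_i-1}.$$ -/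

import Mathlib

open MeasureTheory ProbabilityTheory unitInterval

namespace Percolation

/-- The Cartesian product of a family of graphs: two vertices are adjacent if they are adjacent in
one coordinate and agree in all the other coordinates. -/
def cartesianProduct {ι : Type*} {V : ι → Type*} (T : ∀ i, SimpleGraph (V i)) :
    SimpleGraph (∀ i, V i) where
  Adj x y := ∃ i, (T i).Adj (x i) (y i) ∧ ∀ j, j ≠ i → x j = y j
  symm := ⟨fun _ _ ⟨i, h, h'⟩ => ⟨i, h.symm, fun j hj => (h' j hj).symm⟩⟩
  loopless := ⟨fun _ ⟨_, h, _⟩ => h.ne rfl⟩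

variable {V : Type*}

/-- The law of Bernoulli bond percolation on `G` with retention probability `p`: the random set of
open edges contains each edge of `G` independently with probability `p`. -/
noncomputable def bondPercolation (G : SimpleGraph V) (p : I) : Measure (Set (Sym2 V)) :=
  setBernoulli G.edgeSet p

/-- The subgraph of `G` (on all vertices) spanned by the open edges of the configuration `ω`. -/
def openSubgraph (G : SimpleGraph V) (ω : Set (Sym2 V)) : SimpleGraph V :=
  SimpleGraph.fromEdgeSet (G.edgeSet ∩ ω)

/-- Some cluster (connected component of the open subgraph) is infinite. -/
def HasInfiniteCluster (G : SimpleGraph V) (ω : Set (Sym2 V)) : Prop :=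
  ∃ C : (openSubgraph G ω).ConnectedComponent, C.supp.Infinite

/-- Exactly one cluster is infinite. -/
def HasUniqueInfiniteCluster (G : SimpleGraph V) (ω : Set (Sym2 V)) : Prop :=
  ∃! C : (openSubgraph G ω).ConnectedComponent, C.supp.Infinite

/-- The critical probability `p_c(G)`: the infimum, in `[0,1]`, of the set of `p` at which there is
almost surely an infinite cluster. -/
noncomputable def pc (G : SimpleGraph V) : I :=
  sInf {p : I | ∀ᵐ ω ∂(bondPercolation G p), HasInfiniteCluster G ω}

/-- The uniqueness threshold `p_u(G)`: the infimum, in `[0,1]`, of the set of `p` at which there is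
almost surely a unique infinite cluster. -/
noncomputable def pu (G : SimpleGraph V) : I :=
  sInf {p : I | ∀ᵐ ω ∂(bondPercolation G p), HasUniqueInfiniteCluster G ω}

end Percolation

/-! Write τ_q(x, y) for the probability that x and y are connected at retention probability q. Below
p_c the two-point function is so small that, as an operator, it is bounded on an explicit positive
function. Boundedness survives an explicit increase of the parameter, and it is incompatible with
uniqueness.

Below p_c: if every finite S around o has an expected number `phi` of open exits at least 1 at q,
the Duminil-Copin–Tassion differential inequality yields percolation at every p > q
(`le_escapeProb`, `pc_le_of_not_subcritical`). So every q < p_c is `Subcritical`, and comparison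
with a branching process of translates of S bounds the expected cluster size (`exists_sum_tau_le`).
By the Harris inequality τ is supermultiplicative along chains of translates. Automorphisms act
transitively on pairs with given coordinate distances (d_i), and at least ∏ (k_i - 1)^(n d_i)
vertices have distances (n d_i) from x. A finite expected cluster size therefore forces τ_q ≤ ∏ (k_i
- 1)^(-d_i), with no multiplicative constant (`mul_tau_le_one`, `tau_le_of_subcritical`). This is
why the gap is explicit.

The weight: the product f of the spherical functions of the trees has adjacency eigenvalue α = 2 ∑
√(k_i - 1). In one tree the sphere of radius d acts on f_i by at most (d + 1) (k_i - 1)^(d/2), so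
summing (d + 1) (k_i - 1)^(-d/2) gives τ_q f ≤ C f with C = ∏ (k_i - 1) / (√(k_i - 1) - 1)^2
(`sum_tau_mul_prod_le`).

Sprinkling: percolation at p is percolation at q plus an independent sprinkling of density δ = (p -
q) / (1 - q). With A the adjacency operator, exploring the q-cluster gives τ_p ≤ τ_q + δ τ_q A τ_p,
hence τ_p f ≤ C f / (1 - δ α C) as long as δ α C < 1, that is, p < q + (1 - q) / (α C)
(`tau_sprinkle_le`, `sum_tau_le_of_lt`). All this is done in finite edge sets with uniform bounds,
which makes the absorption legitimate.

Uniqueness: a Schur test turns the bound into ∑_{W × W} τ_p ≤ M |W|, whereas uniqueness makes this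
sum at least θ² |W|² with θ > 0 (`not_unique_of_sum_tau_le`). Hence p_u ≥ q + (1 - q) / (α C) for q
< p_c, and q is sent to p_c. The gap is strict because p_c ≤ 1/2. -/

namespace Percolation

/-! ### Expectations over random subsets of a finite set -/

section FiniteExpectation

/-- `p e` is a probability for every `e`. -/
def IsProb {E : Type*} (p : E → ℝ) : Prop := ∀ e, 0 ≤ p e ∧ p e ≤ 1

lemma isProb_const {E : Type*} {s : ℝ} (h0 : 0 ≤ s) (h1 : s ≤ 1) : IsProb (fun _ : E => s) :=
  fun _ => ⟨h0, h1⟩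

variable {E : Type*} [DecidableEq E]

/-- The expectation of `g ω`, where `ω` is the random subset of `F` that contains each `e ∈ F`
independently with probability `p e`. -/
noncomputable def ev (F : Finset E) (p : E → ℝ) (g : Finset E → ℝ) : ℝ :=
  ∑ ω ∈ F.powerset, (∏ e ∈ F, if e ∈ ω then p e else 1 - p e) * g ω

@[simp] lemma ev_empty (p : E → ℝ) (g : Finset E → ℝ) : ev ∅ p g = g ∅ := by simp [ev]

/-- Conditioning on the state of one edge. The main properties of `ev` follow from it by induction
on the edge set. -/
lemma ev_insert {e : E} {F : Finset E} (he : e ∉ F) (p : E → ℝ) (g : Finset E → ℝ) :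
    ev (insert e F) p g = p e * ev F p (fun ω => g (insert e ω)) + (1 - p e) * ev F p g := by
  unfold ev
  rw [Finset.sum_powerset_insert he, add_comm, Finset.mul_sum, Finset.mul_sum]
  congr 1
  · refine Finset.sum_congr rfl fun ω hω => ?_
    have hω' := Finset.mem_powerset.1 hω
    rw [Finset.prod_insert he, if_pos (Finset.mem_insert_self _ _), mul_assoc]
    congr 2
    refine Finset.prod_congr rfl fun a ha => ?_
    have : a ≠ e := fun h => he (h ▸ ha)
    simp [this]
  · refine Finset.sum_congr rfl fun ω hω => ?_
    have hω' := Finset.mem_powerset.1 hω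
    rw [Finset.prod_insert he, if_neg (fun h => he (hω' h)), mul_assoc]

lemma ev_congr {F : Finset E} {p : E → ℝ} {g h : Finset E → ℝ} (H : ∀ ω ⊆ F, g ω = h ω) :
    ev F p g = ev F p h :=
  Finset.sum_congr rfl fun ω hω => by rw [H ω (Finset.mem_powerset.1 hω)]

lemma ev_congr_prob {F : Finset E} {p p' : E → ℝ} (g : Finset E → ℝ) (H : ∀ e ∈ F, p e = p' e) :
    ev F p g = ev F p' g := by
  unfold ev
  refine Finset.sum_congr rfl fun ω _ => ?_
  congr 1
  exact Finset.prod_congr rfl fun e he => by rw [H e he]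

lemma weight_nonneg {F : Finset E} {p : E → ℝ} (hp : IsProb p) (ω : Finset E) :
    0 ≤ ∏ e ∈ F, if e ∈ ω then p e else 1 - p e :=
  Finset.prod_nonneg fun e _ => by
    have := hp e
    split_ifs <;> linarith

lemma ev_mono {F : Finset E} {p : E → ℝ} (hp : IsProb p) {g h : Finset E → ℝ}
    (H : ∀ ω ⊆ F, g ω ≤ h ω) : ev F p g ≤ ev F p h :=
  Finset.sum_le_sum fun ω hω =>
    mul_le_mul_of_nonneg_left (H ω (Finset.mem_powerset.1 hω)) (weight_nonneg hp ω)

lemma ev_nonneg {F : Finset E} {p : E → ℝ} (hp : IsProb p) {g : Finset E → ℝ}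
    (H : ∀ ω ⊆ F, 0 ≤ g ω) : 0 ≤ ev F p g :=
  Finset.sum_nonneg fun ω hω => mul_nonneg (weight_nonneg hp ω) (H ω (Finset.mem_powerset.1 hω))

lemma ev_add (F : Finset E) (p : E → ℝ) (g h : Finset E → ℝ) :
    ev F p (fun ω => g ω + h ω) = ev F p g + ev F p h := by
  simp [ev, mul_add, Finset.sum_add_distrib]

lemma ev_sub (F : Finset E) (p : E → ℝ) (g h : Finset E → ℝ) :
    ev F p (fun ω => g ω - h ω) = ev F p g - ev F p h := by
  simp [ev, mul_sub, Finset.sum_sub_distrib]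

lemma ev_sum {ι : Type*} (s : Finset ι) (F : Finset E) (p : E → ℝ) (g : ι → Finset E → ℝ) :
    ev F p (fun ω => ∑ i ∈ s, g i ω) = ∑ i ∈ s, ev F p (g i) := by
  simp only [ev, Finset.mul_sum]
  exact Finset.sum_comm

lemma ev_const_mul (F : Finset E) (p : E → ℝ) (c : ℝ) (g : Finset E → ℝ) :
    ev F p (fun ω => c * g ω) = c * ev F p g := by
  simp only [ev, Finset.mul_sum]
  exact Finset.sum_congr rfl fun _ _ => by ring

lemma ev_mul_const (F : Finset E) (p : E → ℝ) (c : ℝ) (g : Finset E → ℝ) :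
    ev F p (fun ω => g ω * c) = ev F p g * c := by
  simp only [ev, Finset.sum_mul]
  exact Finset.sum_congr rfl fun _ _ => by ring

lemma ev_const (F : Finset E) (p : E → ℝ) (c : ℝ) : ev F p (fun _ => c) = c := by
  induction F using Finset.induction_on with
  | empty => simp
  | insert e F he ih => rw [ev_insert he, ih]; ring

lemma ev_le_one {F : Finset E} {p : E → ℝ} (hp : IsProb p) {g : Finset E → ℝ}
    (H : ∀ ω ⊆ F, g ω ≤ 1) : ev F p g ≤ 1 :=
  (ev_mono hp H).trans_eq (ev_const F p 1)

/-- Independence of disjoint blocks. -/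
lemma ev_union {A B : Finset E} (h : Disjoint A B) (p : E → ℝ) (g : Finset E → ℝ) :
    ev (A ∪ B) p g = ev A p fun a => ev B p fun b => g (a ∪ b) := by
  induction A using Finset.induction_on generalizing g with
  | empty => simp
  | insert e A he ih =>
    rw [Finset.disjoint_insert_left] at h
    rw [Finset.insert_union, ev_insert (by simp [he, h.1]), ev_insert he, ih h.2, ih h.2]
    simp only [Finset.insert_union]

lemma ev_sdiff {A F : Finset E} (h : A ⊆ F) (p : E → ℝ) (g : Finset E → ℝ) :
    ev F p g = ev A p fun a => ev (F \ A) p fun b => g (a ∪ b) := by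
  rw [← ev_union Finset.disjoint_sdiff, Finset.union_sdiff_of_subset h]

lemma ev_of_local {A F : Finset E} (h : A ⊆ F) (p : E → ℝ) {g : Finset E → ℝ}
    (hg : ∀ ω ⊆ F, g ω = g (ω ∩ A)) : ev F p g = ev A p g := by
  rw [ev_sdiff h]
  refine ev_congr fun a ha => ?_
  rw [← ev_const (F \ A) p (g a)]
  refine ev_congr fun b hb => ?_
  rw [hg (a ∪ b) (Finset.union_subset (ha.trans h) (hb.trans Finset.sdiff_subset))]
  congr 1
  ext e
  have h1 := @ha e
  have h2 := @hb e
  simp only [Finset.mem_sdiff] at h2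
  simp only [Finset.mem_inter, Finset.mem_union]
  tauto

lemma ev_eq_of_zero {F : Finset E} {p : E → ℝ} (hp : ∀ e ∈ F, p e = 0) (g : Finset E → ℝ) :
    ev F p g = g ∅ := by
  induction F using Finset.induction_on generalizing g with
  | empty => simp
  | insert e F he ih =>
    rw [ev_insert he, hp e (Finset.mem_insert_self _ _),
      ih (fun e' h' => hp e' (Finset.mem_insert_of_mem h'))]
    ring_nf
    rw [ih (fun e' h' => hp e' (Finset.mem_insert_of_mem h'))]

lemma ev_eq_of_zero_off {A F : Finset E} (h : A ⊆ F) {p : E → ℝ} (hp : ∀ e ∈ F \ A, p e = 0)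
    (g : Finset E → ℝ) : ev F p g = ev A p g := by
  rw [ev_sdiff h]
  exact ev_congr fun a _ => by rw [ev_eq_of_zero hp]; simp

/-- The union of two independent random sets is a random set of the same kind. -/
lemma ev_sprinkle (F : Finset E) (p δ : E → ℝ) (g : Finset E → ℝ) :
    ev F (fun e => 1 - (1 - p e) * (1 - δ e)) g =
      ev F p fun ω => ev F δ fun η => g (ω ∪ η) := by
  induction F using Finset.induction_on generalizing g with
  | empty => simp
  | insert e F he ih =>
    rw [ev_insert he, ih, ih, ev_insert he]
    simp only [ev_insert he, Finset.insert_union, Finset.union_insert, Finset.insert_idem, ev_add,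
      ev_const_mul]
    ring

/-- The Harris inequality: increasing functions are positively correlated. -/
lemma ev_mul_ev_le {F : Finset E} {p : E → ℝ} (hp : IsProb p) {g h : Finset E → ℝ}
    (hg : Monotone g) (hh : Monotone h) :
    ev F p g * ev F p h ≤ ev F p (fun ω => g ω * h ω) := by
  induction F using Finset.induction_on generalizing g h with
  | empty => simp
  | insert e F he ih =>
    have hg' : Monotone fun ω => g (insert e ω) :=
      fun _ _ hab => hg (Finset.insert_subset_insert e hab)
    have hh' : Monotone fun ω => h (insert e ω) :=
      fun _ _ hab => hh (Finset.insert_subset_insert e hab)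
    have h1 := ih hg hh
    have h2 := ih hg' hh'
    have a1 : ev F p g ≤ ev F p fun ω => g (insert e ω) :=
      ev_mono hp fun ω _ => hg (Finset.subset_insert e ω)
    have a2 : ev F p h ≤ ev F p fun ω => h (insert e ω) :=
      ev_mono hp fun ω _ => hh (Finset.subset_insert e ω)
    rw [ev_insert he, ev_insert he, ev_insert he]
    obtain ⟨p0, p1⟩ := hp e
    have k1 := mul_le_mul_of_nonneg_left h1 (sub_nonneg.2 p1)
    have k2 := mul_le_mul_of_nonneg_left h2 p0
    have k3 := mul_nonneg (mul_nonneg p0 (sub_nonneg.2 p1))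
      (mul_nonneg (sub_nonneg.2 a1) (sub_nonneg.2 a2))
    nlinarith

lemma ev_mono_prob {F : Finset E} {p p' : E → ℝ} (hp : IsProb p) (hp' : IsProb p')
    (hpp : ∀ e, p e ≤ p' e) {g : Finset E → ℝ} (hg : Monotone g) : ev F p g ≤ ev F p' g := by
  induction F using Finset.induction_on generalizing g with
  | empty => simp
  | insert e F he ih =>
    have hg' : Monotone fun ω => g (insert e ω) :=
      fun _ _ hab => hg (Finset.insert_subset_insert e hab)
    have h1 := ih hg
    have h2 := ih hg'
    have a1 : ev F p g ≤ ev F p fun ω => g (insert e ω) :=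
      ev_mono hp fun ω _ => hg (Finset.subset_insert e ω)
    rw [ev_insert he, ev_insert he]
    obtain ⟨p0, p1⟩ := hp' e
    nlinarith [mul_le_mul_of_nonneg_left h1 (sub_nonneg.2 p1), mul_le_mul_of_nonneg_left h2 p0,
      mul_nonneg (sub_nonneg.2 (hpp e)) (sub_nonneg.2 a1)]

lemma ev_mono_set {A F : Finset E} (h : A ⊆ F) {p : E → ℝ} (hp : IsProb p) {g : Finset E → ℝ}
    (hg : Monotone g) : ev A p g ≤ ev F p g := by
  rw [ev_sdiff h]
  refine ev_mono hp fun a _ => ?_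
  rw [← ev_const (F \ A) p (g a)]
  exact ev_mono hp fun b _ => hg Finset.subset_union_left

/-- Russo's formula. -/
lemma hasDerivAt_ev (F : Finset E) (g : Finset E → ℝ) (s : ℝ) :
    HasDerivAt (fun s : ℝ => ev F (fun _ => s) g)
      (∑ e ∈ F, ev F (fun _ => s) (fun ω => g (insert e ω) - g (ω.erase e))) s := by
  induction F using Finset.induction_on generalizing g with
  | empty => simpa using hasDerivAt_const s (g ∅)
  | insert e F he ih =>
    simp only [ev_insert he]
    have h1 := (hasDerivAt_id s).mul (ih fun ω => g (insert e ω))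
    have h2 := ((hasDerivAt_const s (1 : ℝ)).sub (hasDerivAt_id s)).mul (ih g)
    refine (h1.add h2).congr_deriv ?_
    rw [Finset.sum_insert he]
    -- The pivotal difference at `e` does not depend on the state of `e`, so it has the same value
    -- in both branches, and the weights s and 1 - s recombine.
    have e1 : ev F (fun _ => s) (fun ω => g (insert e (insert e ω)) - g ((insert e ω).erase e)) =
        ev F (fun _ => s) (fun ω => g (insert e ω)) - ev F (fun _ => s) g := by
      rw [← ev_sub]
      exact ev_congr fun ω hω => by
        rw [Finset.insert_idem, Finset.erase_insert (fun h => he (hω h))]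
    have e2 : ev F (fun _ => s) (fun ω => g (insert e ω) - g (ω.erase e)) =
        ev F (fun _ => s) (fun ω => g (insert e ω)) - ev F (fun _ => s) g := by
      rw [← ev_sub]
      exact ev_congr fun ω hω => by rw [Finset.erase_eq_of_notMem (fun h => he (hω h))]
    have e3 : ∑ x ∈ F, ev F (fun _ => s) (fun ω => g (insert x (insert e ω)) -
          g ((insert e ω).erase x)) =
        ∑ x ∈ F, ev F (fun _ => s) (fun ω => g (insert e (insert x ω)) -
          g (insert e (ω.erase x))) := by
      refine Finset.sum_congr rfl fun x hx => ev_congr fun ω _ => ?_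
      have hxe : e ≠ x := fun h => he (h ▸ hx)
      rw [Finset.insert_comm, Finset.erase_insert_of_ne hxe]
    rw [e1, e2, Finset.sum_add_distrib, ← Finset.mul_sum, ← Finset.mul_sum, e3]
    simp only [one_mul, id_eq, zero_sub, Pi.sub_apply]
    ring

lemma ev_image {E' : Type*} [DecidableEq E'] (φ : E ↪ E') (F : Finset E) (p : E' → ℝ)
    (g : Finset E' → ℝ) :
    ev (F.map φ) p g = ev F (fun e => p (φ e)) (fun ω => g (ω.map φ)) := by
  induction F using Finset.induction_on generalizing g with
  | empty => simp
  | insert e F he ih =>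
    rw [Finset.map_insert, ev_insert (by simpa using he), ev_insert he, ih, ih]
    simp only [Finset.map_insert]

end FiniteExpectation

/-! ### Connection probabilities, cluster exploration and sprinkling -/

section Exploration

open scoped Classical

variable {V : Type*}

/-- The indicator of a proposition. -/
noncomputable def ind (P : Prop) : ℝ := if P then 1 else 0

lemma ind_nonneg (P : Prop) : 0 ≤ ind P := by unfold ind; split_ifs <;> norm_num

lemma ind_le_one (P : Prop) : ind P ≤ 1 := by unfold ind; split_ifs <;> norm_num

lemma ind_of {P : Prop} (h : P) : ind P = 1 := if_pos h

lemma ind_of_not {P : Prop} (h : ¬P) : ind P = 0 := if_neg h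

lemma ind_mono {P Q : Prop} (h : P → Q) : ind P ≤ ind Q := by
  by_cases hP : P
  · rw [ind_of hP, ind_of (h hP)]
  · rw [ind_of_not hP]; exact ind_nonneg Q

lemma ind_and (P Q : Prop) : ind (P ∧ Q) = ind P * ind Q := by
  by_cases hP : P <;> by_cases hQ : Q <;> simp [ind, hP, hQ]

/-- The vertices `x` and `y` are connected by edges of `ω`. -/
def Conn (ω : Set (Sym2 V)) (x y : V) : Prop := (SimpleGraph.fromEdgeSet ω).Reachable x y

lemma Conn.refl (ω : Set (Sym2 V)) (x : V) : Conn ω x x := SimpleGraph.Reachable.refl _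

lemma Conn.symm {ω : Set (Sym2 V)} {x y : V} (h : Conn ω x y) : Conn ω y x :=
  SimpleGraph.Reachable.symm h

lemma Conn.trans {ω : Set (Sym2 V)} {x y z : V} (h : Conn ω x y) (h' : Conn ω y z) :
    Conn ω x z := SimpleGraph.Reachable.trans h h'

lemma Conn.mono {ω ω' : Set (Sym2 V)} (hω : ω ⊆ ω') {x y : V} (h : Conn ω x y) : Conn ω' x y :=
  SimpleGraph.Reachable.mono (SimpleGraph.fromEdgeSet_mono hω) h

lemma Conn.of_mem {ω : Set (Sym2 V)} {x y : V} (h : s(x, y) ∈ ω) : Conn ω x y := by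
  by_cases hxy : x = y
  · subst hxy; exact Conn.refl _ _
  · exact SimpleGraph.Adj.reachable (by simp [h, hxy])

lemma Conn.induction {ω : Set (Sym2 V)} {x : V} {P : V → Prop} (h0 : P x)
    (hs : ∀ u v, Conn ω x u → s(u, v) ∈ ω → P u → P v) {y : V} (h : Conn ω x y) : P y := by
  have h' := (SimpleGraph.reachable_iff_reflTransGen x y).1 h
  induction h' with
  | refl => exact h0
  | tail hb hc ih =>
    have hb' := (SimpleGraph.reachable_iff_reflTransGen _ _).2 hb
    exact hs _ _ hb' (by simpa using (SimpleGraph.fromEdgeSet_adj _ |>.1 hc).1) (ih hb')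

/-- A path is transferred edge by edge. Each transfer may use that the current vertex is reached in
both configurations, so that locality statements can be proved in both directions. -/
lemma Conn.of_edges {ω ω' : Set (Sym2 V)} {x : V}
    (hs : ∀ u v, Conn ω x u → Conn ω' x u → s(u, v) ∈ ω → s(u, v) ∈ ω') {y : V}
    (h : Conn ω x y) : Conn ω' x y :=
  Conn.induction (Conn.refl _ _) (fun u v hu huv hu' => hu'.trans (.of_mem (hs u v hu hu' huv))) h

/-- The edges of `F` that touch the vertex set `K`. -/
noncomputable def touching (F : Finset (Sym2 V)) (K : Finset V) : Finset (Sym2 V) :=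
  F.filter fun e => ∃ z ∈ K, z ∈ e

/-- A connection from inside `K` to outside `K` has a last edge leaving `K`. -/
lemma Conn.exists_last_exit {ω : Finset (Sym2 V)} {F : Finset (Sym2 V)}
    {K : Finset V} {x y : V} (hx : x ∈ K) (hy : y ∉ K) (h : Conn (ω : Set (Sym2 V)) x y) :
    ∃ u v, u ∈ K ∧ v ∉ K ∧ s(u, v) ∈ ω ∧ Conn (↑(ω \ touching F K) : Set (Sym2 V)) v y := by
  -- The path is followed backwards from y: its first entrance into `K` is the last exit as seen
  -- from x.
  suffices H : ∀ z, Conn (ω : Set (Sym2 V)) y z → (∃ u v, u ∈ K ∧ v ∉ K ∧ s(u, v) ∈ ω ∧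
      Conn (↑(ω \ touching F K) : Set (Sym2 V)) v y) ∨
      (z ∉ K ∧ Conn (↑(ω \ touching F K) : Set (Sym2 V)) z y) by
    rcases H x h.symm with h | h
    · exact h
    · exact absurd hx h.1
  intro z hz
  refine Conn.induction (P := fun z => (∃ u v, u ∈ K ∧ v ∉ K ∧ s(u, v) ∈ ω ∧
      Conn (↑(ω \ touching F K) : Set (Sym2 V)) v y) ∨
      (z ∉ K ∧ Conn (↑(ω \ touching F K) : Set (Sym2 V)) z y)) (Or.inr ⟨hy, Conn.refl _ _⟩) ?_ hz
  intro u v _ huv ih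
  rcases ih with ih | ⟨hu, ih⟩
  · exact Or.inl ih
  have huv' : s(v, u) ∈ ω := by rw [Sym2.eq_swap]; exact_mod_cast huv
  by_cases hv : v ∈ K
  · exact Or.inl ⟨v, u, hv, hu, huv', ih⟩
  · refine Or.inr ⟨hv, (Conn.of_mem ?_).trans ih⟩
    simp only [Finset.coe_sdiff, Set.mem_sdiff, Finset.mem_coe, huv', true_and, touching,
      Finset.mem_filter, not_and]
    rintro _ ⟨z, hzK, hz⟩
    rcases Sym2.mem_iff.1 hz with rfl | rfl <;> contradiction

/-- The connection probability between `x` and `y` inside the finite edge set `F`. -/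
noncomputable def tau (F : Finset (Sym2 V)) (p : Sym2 V → ℝ) (x y : V) : ℝ :=
  ev F p fun ω => ind (Conn (ω : Set (Sym2 V)) x y)

lemma monotone_ind_conn (x y : V) :
    Monotone fun ω : Finset (Sym2 V) => ind (Conn (ω : Set (Sym2 V)) x y) :=
  fun _ _ h => ind_mono (Conn.mono (by exact_mod_cast h))

variable {F : Finset (Sym2 V)} {p δ : Sym2 V → ℝ}

lemma tau_nonneg (hp : IsProb p) (x y : V) : 0 ≤ tau F p x y :=
  ev_nonneg hp fun _ _ => ind_nonneg _

lemma tau_le_one (hp : IsProb p) (x y : V) : tau F p x y ≤ 1 :=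
  ev_le_one hp fun _ _ => ind_le_one _

lemma tau_self (x : V) : tau F p x x = 1 := by
  unfold tau
  simp only [ind_of (Conn.refl _ x)]
  exact ev_const _ _ _

lemma tau_comm (x y : V) : tau F p x y = tau F p y x :=
  ev_congr fun ω _ => by rw [show Conn (ω : Set (Sym2 V)) x y = Conn (ω : Set (Sym2 V)) y x from
    propext ⟨Conn.symm, Conn.symm⟩]

lemma tau_mono_set {A : Finset (Sym2 V)} (h : A ⊆ F) (hp : IsProb p) (x y : V) :
    tau A p x y ≤ tau F p x y := ev_mono_set h hp (monotone_ind_conn x y)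

lemma tau_mono_prob {p' : Sym2 V → ℝ} (hp : IsProb p) (hp' : IsProb p') (h : ∀ e, p e ≤ p' e)
    (x y : V) : tau F p x y ≤ tau F p' x y := ev_mono_prob hp hp' h (monotone_ind_conn x y)

/-- Both events are increasing, so Harris bounds the product by the probability of their
intersection, and the connections concatenate. -/
lemma tau_mul_tau_le (hp : IsProb p) (x y z : V) : tau F p x y * tau F p y z ≤ tau F p x z := by
  refine (ev_mul_ev_le hp (monotone_ind_conn x y) (monotone_ind_conn y z)).trans
    (ev_mono hp fun ω _ => ?_)
  rw [← ind_and]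
  exact ind_mono fun h => h.1.trans h.2

/-- A vertex touched by no edge of `F` is connected to itself only. -/
lemma tau_eq_zero {Z : Finset V} (hZ : ∀ u v, s(u, v) ∈ F → v ∈ Z) {x y : V} (hxy : x ≠ y)
    (hy : y ∉ Z) : tau F p x y = 0 := by
  unfold tau
  rw [← ev_const F p 0]
  refine ev_congr fun ω hω => ind_of_not fun h => ?_
  have : y = x ∨ y ∈ Z := Conn.induction (P := fun y => y = x ∨ y ∈ Z) (Or.inl rfl)
    (fun u v _ huv _ => Or.inr (hZ u v (hω (by exact_mod_cast huv)))) h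
  rcases this with h | h
  · exact hxy h.symm
  · exact hy h

lemma ev_mem {E : Type*} [DecidableEq E] {F : Finset E} {e : E} (he : e ∈ F) (p : E → ℝ) :
    ev F p (fun ω => ind (e ∈ ω)) = p e := by
  rw [ev_of_local (A := {e}) (by simpa using he) p
    (fun ω _ => by simp), ← insert_empty_eq, ev_insert (by simp)]
  simp [ind]

/-- Independence of disjoint edge sets: `a` sees only `A`, and `c` is evaluated only off `A`. -/
lemma ev_mul_of_local {E : Type*} [DecidableEq E] {A F : Finset E} (h : A ⊆ F) (p : E → ℝ)
    {a : Finset E → ℝ}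
    (c : Finset E → ℝ) (ha : ∀ ω ⊆ F, a ω = a (ω ∩ A)) :
    ev F p (fun ω => a ω * c (ω \ A)) = ev F p a * ev F p (fun ω => c (ω \ A)) := by
  have h1 : ∀ s ⊆ A, ∀ t ⊆ F \ A, (s ∪ t) ∩ A = s ∧ (s ∪ t) \ A = t := by
    intro s hs t ht
    constructor
    · ext e
      have := @hs e; have := @ht e
      simp only [Finset.mem_sdiff] at this
      simp only [Finset.mem_inter, Finset.mem_union]; tauto
    · ext e
      have := @hs e; have := @ht e
      simp only [Finset.mem_sdiff] at this
      simp only [Finset.mem_sdiff, Finset.mem_union]; tauto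
  have h2 : ev F p (fun ω => c (ω \ A)) = ev (F \ A) p c := by
    rw [ev_sdiff h, ← ev_const A p (ev (F \ A) p c)]
    exact ev_congr fun s hs => ev_congr fun t ht => by rw [(h1 s hs t ht).2]
  rw [ev_sdiff h, h2, ev_of_local h p ha, ← ev_mul_const]
  refine ev_congr fun s hs => ?_
  rw [← ev_const_mul]
  refine ev_congr fun t ht => ?_
  rw [(h1 s hs t ht).2, ha _ (Finset.union_subset (hs.trans h) (ht.trans Finset.sdiff_subset)),
    (h1 s hs t ht).1]

/-- The probability that the cluster `K` is explored, that an edge at `K` is open in the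
sprinkling, and that a given event occurs off `K`, factorizes. -/
lemma ev_ev_factor {E : Type*} [DecidableEq E] {A F : Finset E} (h : A ⊆ F) (p δ : E → ℝ)
    {a b : Finset E → ℝ}
    (c : Finset E → ℝ) (ha : ∀ ω ⊆ F, a ω = a (ω ∩ A)) (hb : ∀ ω ⊆ F, b ω = b (ω ∩ A)) :
    ev F p (fun ω => ev F δ fun η => a ω * (b η * c ((ω ∪ η) \ A))) =
      ev F p a * (ev F δ b *
        ev F (fun e => 1 - (1 - p e) * (1 - δ e)) (fun ω => c (ω \ A))) := by
  have h1 : ∀ ω, ev F δ (fun η => a ω * (b η * c ((ω ∪ η) \ A))) =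
      a ω * (fun ω' => ev F δ b * ev F δ fun η => c (ω' ∪ (η \ A))) (ω \ A) := by
    intro ω
    rw [ev_const_mul]
    congr 1
    simp only [Finset.union_sdiff_distrib]
    exact ev_mul_of_local h δ (fun η => c (ω \ A ∪ η)) hb
  simp only [h1]
  rw [ev_mul_of_local h p (fun ω' => ev F δ b * ev F δ fun η => c (ω' ∪ (η \ A))) ha,
    ev_const_mul, ev_sprinkle]
  simp only [Finset.union_sdiff_distrib]

/-- Exploring the cluster `K` of x inspects only edges touching `K`, since a path can leave `K` only
through such an edge. Everything off `K` is therefore still independent once the cluster is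
revealed. -/
lemma cluster_local {ω F : Finset (Sym2 V)} (hω : ω ⊆ F) (x : V) (K : Finset V) :
    (∀ z, Conn (ω : Set (Sym2 V)) x z ↔ z ∈ K) ↔
      (∀ z, Conn (↑(ω ∩ touching F K) : Set (Sym2 V)) x z ↔ z ∈ K) := by
  have mono : ∀ z, Conn (↑(ω ∩ touching F K) : Set (Sym2 V)) x z → Conn (ω : Set (Sym2 V)) x z :=
    fun z => Conn.mono (by exact_mod_cast Finset.inter_subset_left)
  have key : (∀ u, Conn (ω : Set (Sym2 V)) x u → Conn (↑(ω ∩ touching F K) : Set (Sym2 V)) x u →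
      u ∈ K) → ∀ z, Conn (ω : Set (Sym2 V)) x z → Conn (↑(ω ∩ touching F K) : Set (Sym2 V)) x z := by
    intro H z hz
    refine Conn.of_edges (fun u v hu hu' huv => ?_) hz
    have huv' : s(u, v) ∈ ω := by exact_mod_cast huv
    simp only [touching, Finset.coe_inter, Set.mem_inter_iff, Finset.mem_coe, huv', true_and,
      Finset.mem_filter, hω huv']
    exact ⟨u, H u hu hu', by simp⟩
  constructor
  · exact fun H z => ⟨fun h => (H z).1 (mono z h), fun h => key (fun u hu _ => (H u).1 hu) z
      ((H z).2 h)⟩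
  · exact fun H z => ⟨fun h => (H z).1 (key (fun u _ hu => (H u).1 hu) z h),
      fun h => mono z ((H z).2 h)⟩

/-- Exploring the cluster of `x` in a first configuration with edge probabilities `p`, and then
adding an independent sprinkling with edge probabilities `δ`. -/
lemma tau_sprinkle_le (hp : IsProb p) (hδ : IsProb δ) {Z : Finset V}
    (hZ : ∀ u v, s(u, v) ∈ F → v ∈ Z)
    {x : V} (hx : x ∈ Z) (y : V) :
    tau F (fun e => 1 - (1 - p e) * (1 - δ e)) x y ≤ tau F p x y +
      ∑ u ∈ Z, ∑ v ∈ Z, if s(u, v) ∈ F then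
        tau F p x u * (δ s(u, v) * tau F (fun e => 1 - (1 - p e) * (1 - δ e)) v y) else 0 := by
  set p' : Sym2 V → ℝ := fun e => 1 - (1 - p e) * (1 - δ e) with hp'def
  have hp' : IsProb p' := fun e => by
    have h1 := hp e; have h2 := hδ e
    constructor <;> simp only [hp'def] <;> nlinarith
  let cl : Finset V → Finset (Sym2 V) → Prop := fun K ω => ∀ z, Conn (ω : Set (Sym2 V)) x z ↔ z ∈ K
  -- `K` is the first-stage cluster of x, u v is a sprinkled edge leaving it from u, and v reaches y
  -- off `K`.
  let T : V → V → Finset V → Finset (Sym2 V) → Finset (Sym2 V) → ℝ := fun u v K ω η =>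
    ind (cl K ω ∧ u ∈ K) * (ind (s(u, v) ∈ η) *
      ind (Conn (↑((ω ∪ η) \ touching F K) : Set (Sym2 V)) v y))
  have T_nonneg : ∀ u v K ω η, 0 ≤ T u v K ω η := fun u v K ω η =>
    mul_nonneg (ind_nonneg _) (mul_nonneg (ind_nonneg _) (ind_nonneg _))
  have pointwise : ∀ ω ⊆ F, ∀ η ⊆ F, ind (Conn (↑(ω ∪ η) : Set (Sym2 V)) x y) ≤
      ind (Conn (ω : Set (Sym2 V)) x y) + ∑ u ∈ Z, ∑ v ∈ Z, ∑ K ∈ Z.powerset,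
        (if s(u, v) ∈ F then T u v K ω η else 0) := by
    intro ω hω η hη
    have hnn : ∀ u v K, 0 ≤ (if s(u, v) ∈ F then T u v K ω η else 0) := fun u v K => by
      split_ifs
      · exact T_nonneg ..
      · exact le_rfl
    by_cases h1 : Conn (ω : Set (Sym2 V)) x y
    · rw [ind_of h1]
      exact (ind_le_one _).trans (le_add_of_nonneg_right (Finset.sum_nonneg fun u _ =>
        Finset.sum_nonneg fun v _ => Finset.sum_nonneg fun K _ => hnn u v K))
    by_cases h2 : Conn (↑(ω ∪ η) : Set (Sym2 V)) x y
    swap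
    · rw [ind_of_not h2]
      exact add_nonneg (ind_nonneg _) (Finset.sum_nonneg fun u _ =>
        Finset.sum_nonneg fun v _ => Finset.sum_nonneg fun K _ => hnn u v K)
    let K := Z.filter fun z => Conn (ω : Set (Sym2 V)) x z
    have hK : cl K ω := fun z => by
      simp only [K, Finset.mem_filter, iff_and_self]
      exact Conn.induction (P := fun z => z ∈ Z) hx
        fun u v _ huv _ => hZ u v (hω (by exact_mod_cast huv))
    obtain ⟨u, v, hu, hv, huv, hvy⟩ := Conn.exists_last_exit (F := F)
      ((hK x).1 (Conn.refl _ _)) (fun h => h1 ((hK y).2 h)) h2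
    have huvF : s(u, v) ∈ F := Finset.union_subset hω hη huv
    -- An edge of ω leaving `K` would enlarge the cluster, so the exit edge comes from the
    -- sprinkling.
    have huη : s(u, v) ∈ η := by
      rcases Finset.mem_union.1 huv with h | h
      · exact absurd ((hK v).1 (((hK u).2 hu).trans (Conn.of_mem (by exact_mod_cast h)))) hv
      · exact h
    have huZ : u ∈ Z := (Finset.mem_filter.1 hu).1
    have hvZ : v ∈ Z := hZ u v huvF
    have e1 : T u v K ω η = 1 := by
      simp only [T]
      rw [ind_of ⟨hK, hu⟩, ind_of huη, ind_of hvy]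
      norm_num
    calc ind (Conn (↑(ω ∪ η) : Set (Sym2 V)) x y) ≤ (if s(u, v) ∈ F then T u v K ω η else 0) := by
          rw [if_pos huvF, e1]; exact ind_le_one _
      _ ≤ ∑ K ∈ Z.powerset, (if s(u, v) ∈ F then T u v K ω η else 0) :=
          Finset.single_le_sum (f := fun K => if s(u, v) ∈ F then T u v K ω η else 0)
            (fun K _ => hnn u v K) (Finset.mem_powerset.2 (Finset.filter_subset _ _))
      _ ≤ ∑ v ∈ Z, ∑ K ∈ Z.powerset, (if s(u, v) ∈ F then T u v K ω η else 0) :=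
          Finset.single_le_sum (f := fun v => ∑ K ∈ Z.powerset,
            if s(u, v) ∈ F then T u v K ω η else 0)
            (fun v _ => Finset.sum_nonneg fun K _ => hnn u v K) hvZ
      _ ≤ ∑ u ∈ Z, ∑ v ∈ Z, ∑ K ∈ Z.powerset, (if s(u, v) ∈ F then T u v K ω η else 0) :=
          Finset.single_le_sum (f := fun u => ∑ v ∈ Z, ∑ K ∈ Z.powerset,
            if s(u, v) ∈ F then T u v K ω η else 0)
            (fun u _ => Finset.sum_nonneg fun v _ => Finset.sum_nonneg fun K _ => hnn u v K) huZ
      _ ≤ _ := le_add_of_nonneg_left (ind_nonneg _)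
  -- The three events use the first stage at `K`, the sprinkling at `K`, and both stages off `K`,
  -- hence are independent. Allowing the last connection to use all edges only increases its
  -- probability.
  have hT : ∀ u v K, s(u, v) ∈ F → ev F p (fun ω => ev F δ fun η => T u v K ω η) ≤
      ev F p (fun ω => ind (cl K ω ∧ u ∈ K)) * (δ s(u, v) * tau F p' v y) := by
    intro u v K huv
    by_cases hu : u ∈ K
    swap
    · simp only [T, hu, and_false, ind_of_not not_false, zero_mul]
      simp [ev_const]
    simp only [T, hu, and_true]
    rw [ev_ev_factor (A := touching F K) (Finset.filter_subset _ _) p δ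
      (a := fun ω => ind (cl K ω)) (b := fun η => ind (s(u, v) ∈ η))
      (fun ω => ind (Conn (ω : Set (Sym2 V)) v y))
      (fun ω hω => congrArg ind (propext (cluster_local hω x K)))
      (fun η hη => by
        have : s(u, v) ∈ touching F K := Finset.mem_filter.2 ⟨huv, u, hu, by simp⟩
        simp [this]), ev_mem huv]
    refine mul_le_mul_of_nonneg_left (mul_le_mul_of_nonneg_left ?_ (hδ _).1)
      (ev_nonneg hp fun _ _ => ind_nonneg _)
    exact ev_mono hp' fun ω _ => ind_mono (Conn.mono (by exact_mod_cast Finset.sdiff_subset))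
  -- The cluster of x is a single set, so the events indexed by `K` are disjoint.
  have hsum : ∀ u, ∑ K ∈ Z.powerset, ev F p (fun ω => ind (cl K ω ∧ u ∈ K)) ≤ tau F p x u := by
    intro u
    rw [← ev_sum]
    refine ev_mono hp fun ω _ => ?_
    by_cases h : ∃ K ∈ Z.powerset, cl K ω ∧ u ∈ K
    · obtain ⟨K, hKZ, hK, hu⟩ := h
      rw [Finset.sum_eq_single K, ind_of ⟨hK, hu⟩, ind_of ((hK u).2 hu)]
      · intro K' _ hne
        refine ind_of_not fun h => hne ?_
        ext z
        rw [← hK z, ← h.1 z]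
      · exact fun h => absurd hKZ h
    · rw [Finset.sum_eq_zero fun K hK => ind_of_not fun h' => h ⟨K, hK, h'⟩]
      exact ind_nonneg _
  calc tau F p' x y = ev F p fun ω => ev F δ fun η => ind (Conn (↑(ω ∪ η) : Set (Sym2 V)) x y) :=
        ev_sprinkle F p δ fun ω => ind (Conn (ω : Set (Sym2 V)) x y)
    _ ≤ ev F p fun ω => ev F δ fun η => ind (Conn (ω : Set (Sym2 V)) x y) +
        ∑ u ∈ Z, ∑ v ∈ Z, ∑ K ∈ Z.powerset, (if s(u, v) ∈ F then T u v K ω η else 0) :=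
        ev_mono hp fun ω hω => ev_mono hδ fun η hη => pointwise ω hω η hη
    _ = tau F p x y + ∑ u ∈ Z, ∑ v ∈ Z, ∑ K ∈ Z.powerset,
        (if s(u, v) ∈ F then ev F p (fun ω => ev F δ fun η => T u v K ω η) else 0) := by
        simp only [ev_add, ev_const, ev_sum]
        congr 1
        refine Finset.sum_congr rfl fun u _ => Finset.sum_congr rfl fun v _ =>
          Finset.sum_congr rfl fun K _ => ?_
        split_ifs
        · rfl
        · simp [ev_const]
    _ ≤ _ := by
        refine add_le_add le_rfl (Finset.sum_le_sum fun u _ => Finset.sum_le_sum fun v _ => ?_)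
        split_ifs with huv
        · refine (Finset.sum_le_sum fun K _ => hT u v K huv).trans ?_
          rw [← Finset.sum_mul]
          exact mul_le_mul_of_nonneg_right (hsum u)
            (mul_nonneg (hδ _).1 (tau_nonneg hp' _ _))
        · simp

lemma conn_map (φ : V ≃ V) (ω : Finset (Sym2 V)) (x y : V) :
    Conn (↑(ω.map φ.toEmbedding.sym2Map) : Set (Sym2 V)) (φ x) (φ y) ↔
      Conn (ω : Set (Sym2 V)) x y := by
  have key : ∀ (ψ : V ≃ V) (ω ω' : Set (Sym2 V)), (∀ u v, s(u, v) ∈ ω → s(ψ u, ψ v) ∈ ω') →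
      ∀ x y, Conn ω x y → Conn ω' (ψ x) (ψ y) := fun ψ ω ω' H x y h =>
    Conn.induction (P := fun y => Conn ω' (ψ x) (ψ y)) (Conn.refl _ _)
      (fun u v _ huv hu => hu.trans (Conn.of_mem (H u v huv))) h
  constructor
  · intro h
    have := key φ.symm _ (ω : Set (Sym2 V)) (fun u v huv => ?_) _ _ h
    · simpa using this
    · simp only [Finset.coe_map, Set.mem_image, Finset.mem_coe] at huv ⊢
      obtain ⟨e, he, heq⟩ := huv
      have : e = s(φ.symm u, φ.symm v) := by
        apply φ.toEmbedding.sym2Map.injective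
        rw [heq]
        simp [Function.Embedding.sym2Map]
      rwa [this] at he
  · refine key φ _ _ (fun u v huv => ?_) x y
    simp only [Finset.coe_map, Set.mem_image, Finset.mem_coe] at huv ⊢
    exact ⟨s(u, v), huv, by simp [Function.Embedding.sym2Map]⟩

lemma tau_map (φ : V ≃ V) (F : Finset (Sym2 V)) (s : ℝ) (x y : V) :
    tau (F.map φ.toEmbedding.sym2Map) (fun _ => s) (φ x) (φ y) = tau F (fun _ => s) x y := by
  unfold tau
  rw [ev_image]
  exact ev_congr fun ω _ => congrArg ind (propext (conn_map φ ω x y))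

end Exploration

/-! ### The Duminil-Copin–Tassion criterion -/

section Sharpness

open scoped Classical

variable {V : Type*} (G : SimpleGraph V)

/-- The edges of `G` with both ends in `S`. -/
noncomputable def edgesIn (S : Finset V) : Finset (Sym2 V) := S.sym2.filter (· ∈ G.edgeSet)

lemma mem_edgesIn {S : Finset V} {u v : V} :
    s(u, v) ∈ edgesIn G S ↔ u ∈ S ∧ v ∈ S ∧ G.Adj u v := by
  simp [edgesIn, and_assoc]

/-- The vertex `x` is connected to the complement of `Λ`. -/
def Escapes (Λ : Finset V) (ω : Set (Sym2 V)) (x : V) : Prop := ∃ z, z ∉ Λ ∧ Conn ω x z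

lemma Escapes.mono {Λ : Finset V} {ω ω' : Set (Sym2 V)} (h : ω ⊆ ω') {x : V}
    (hx : Escapes Λ ω x) : Escapes Λ ω' x := by
  obtain ⟨z, hz, hc⟩ := hx
  exact ⟨z, hz, hc.mono h⟩

/-- Every vertex on a path from outside `Λ` back to z escapes, so none lies in `S` and no edge
inside `S` is used. Both forms of escape are offered to `H` so that it serves both directions of
`nonescaping_local`. -/
lemma escapes_off_of_escapes {Λ S : Finset V} {ω : Finset (Sym2 V)}
    (H : ∀ u, Escapes Λ (ω : Set (Sym2 V)) u →
      Escapes Λ (↑(ω \ edgesIn G S) : Set (Sym2 V)) u → u ∉ S) {z : V}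
    (hz : Escapes Λ (ω : Set (Sym2 V)) z) : Escapes Λ (↑(ω \ edgesIn G S) : Set (Sym2 V)) z := by
  obtain ⟨w, hw, hzw⟩ := hz
  refine ⟨w, hw, Conn.symm (Conn.of_edges (fun u v hu hu' huv => ?_) hzw.symm)⟩
  have huS := H u ⟨w, hw, hu.symm⟩ ⟨w, hw, hu'.symm⟩
  simp only [Finset.coe_sdiff, Set.mem_sdiff, Finset.mem_coe, mem_edgesIn]
  exact ⟨by exact_mod_cast huv, fun h => huS h.1⟩

/-- The set of non-escaping vertices can be discovered by exploring from outside `Λ`, which never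
inspects an edge with both ends in it. The event that it equals `S` is thus independent of the
configuration inside `S`. -/
lemma nonescaping_local (Λ S : Finset V) (ω : Finset (Sym2 V)) :
    (∀ z, z ∈ S ↔ ¬ Escapes Λ (ω : Set (Sym2 V)) z) ↔
      (∀ z, z ∈ S ↔ ¬ Escapes Λ (↑(ω \ edgesIn G S) : Set (Sym2 V)) z) := by
  have mono : ∀ z, Escapes Λ (↑(ω \ edgesIn G S) : Set (Sym2 V)) z →
      Escapes Λ (ω : Set (Sym2 V)) z :=
    fun z => Escapes.mono (by exact_mod_cast Finset.sdiff_subset)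
  constructor
  · intro H z
    rw [H z, not_iff_not]
    exact ⟨escapes_off_of_escapes G fun u hu _ h => (H u).1 h hu, mono z⟩
  · intro H z
    rw [H z, not_iff_not]
    exact ⟨mono z, escapes_off_of_escapes G fun u _ hu h => (H u).1 h hu⟩

variable [G.LocallyFinite]

/-- The edges of `G` with at least one end in `S`. -/
noncomputable def edgesAt (S : Finset V) : Finset (Sym2 V) :=
  S.biUnion fun u => (G.neighborFinset u).image fun v => s(u, v)

lemma mem_edgesAt {S : Finset V} {u v : V} :
    s(u, v) ∈ edgesAt G S ↔ G.Adj u v ∧ (u ∈ S ∨ v ∈ S) := by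
  simp only [edgesAt, Finset.mem_biUnion, Finset.mem_image, SimpleGraph.mem_neighborFinset]
  constructor
  · rintro ⟨a, ha, b, hab, h⟩
    rcases Sym2.eq_iff.1 h with ⟨rfl, rfl⟩ | ⟨rfl, rfl⟩
    · exact ⟨hab, Or.inl ha⟩
    · exact ⟨hab.symm, Or.inr ha⟩
  · rintro ⟨h, hu | hv⟩
    · exact ⟨u, hu, v, h, rfl⟩
    · exact ⟨v, hv, u, h.symm, Sym2.eq_swap⟩

lemma edgesIn_subset_edgesAt {S Λ : Finset V} (h : S ⊆ Λ) : edgesIn G S ⊆ edgesAt G Λ := by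
  intro e
  induction e using Sym2.ind with
  | _ u v =>
    rw [mem_edgesIn, mem_edgesAt]
    exact fun H => ⟨H.2.2, Or.inl (h H.1)⟩

/-- The neighbours of `u` outside `S`. -/
noncomputable def exits (S : Finset V) (u : V) : Finset V :=
  (G.neighborFinset u).filter (· ∉ S)

lemma mem_exits {S : Finset V} {u v : V} : v ∈ exits G S u ↔ G.Adj u v ∧ v ∉ S := by
  simp [exits]

/-- The expected number of open edges leaving `S` from a vertex connected to `o` within `S`. -/
noncomputable def phi (q : ℝ) (S : Finset V) (o : V) : ℝ :=
  ∑ u ∈ S, ∑ _v ∈ exits G S u, tau (edgesIn G S) (fun _ => q) o u * q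

/-- Some finite set `S` around `o` satisfies `phi < 1`. -/
def Subcritical (o : V) (q : ℝ) : Prop := ∃ S : Finset V, o ∈ S ∧ phi G q S o < 1

/-- The probability that `x` is connected to the complement of `Λ`. -/
noncomputable def escapeProb (Λ : Finset V) (s : ℝ) (x : V) : ℝ :=
  ev (edgesAt G Λ) (fun _ => s) fun ω => ind (Escapes Λ (ω : Set (Sym2 V)) x)

/-- If o reaches u inside `S`, opening an exit edge u v makes o escape, since v already does: such
an edge is pivotal. Only one end of it lies in `S`, so distinct exits give distinct edges. -/
lemma sum_exits_le_pivotal {Λ : Finset V} {o : V} {ω : Finset (Sym2 V)}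
    (ho : ¬ Escapes Λ (ω : Set (Sym2 V)) o) {S : Finset V} (hSΛ : S ⊆ Λ)
    (hS : ∀ z, z ∈ S ↔ ¬ Escapes Λ (ω : Set (Sym2 V)) z) :
    ∑ u ∈ S, ∑ _v ∈ exits G S u, ind (Conn (↑(ω ∩ edgesIn G S) : Set (Sym2 V)) o u) ≤
      ∑ e ∈ edgesAt G Λ, (ind (Escapes Λ (↑(insert e ω) : Set (Sym2 V)) o) -
        ind (Escapes Λ (↑(ω.erase e) : Set (Sym2 V)) o)) := by
  have herase : ∀ e, ind (Escapes Λ (↑(ω.erase e) : Set (Sym2 V)) o) = 0 := fun e =>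
    ind_of_not fun h => ho (h.mono (by exact_mod_cast Finset.erase_subset _ _))
  simp only [herase, sub_zero]
  rw [Finset.sum_sigma']
  have hinj : Set.InjOn (fun a : (_ : V) × V => s(a.1, a.2)) (S.sigma (exits G S)) := by
    rintro ⟨a, b⟩ hab ⟨c, d⟩ hcd h
    simp only [Finset.coe_sigma, Set.mem_sigma_iff, Finset.mem_coe, mem_exits] at hab hcd
    rcases Sym2.eq_iff.1 h with ⟨h1, h2⟩ | ⟨h1, h2⟩
    · dsimp at h1 h2; subst h1; subst h2; rfl
    · dsimp at h1 h2; subst h1; exact absurd hab.1 hcd.2.2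
  calc ∑ a ∈ S.sigma (exits G S), ind (Conn (↑(ω ∩ edgesIn G S) : Set (Sym2 V)) o a.1)
      ≤ ∑ a ∈ S.sigma (exits G S), ind (Escapes Λ (↑(insert s(a.1, a.2) ω) : Set (Sym2 V)) o) := by
        refine Finset.sum_le_sum fun a ha => ind_mono fun h => ?_
        simp only [Finset.mem_sigma, mem_exits] at ha
        have hv : Escapes Λ (ω : Set (Sym2 V)) a.2 := by
          by_contra hc; exact ha.2.2 ((hS a.2).2 hc)
        obtain ⟨w, hw, hc⟩ := hv
        have h1 : (ω : Set (Sym2 V)) ⊆ ↑(insert s(a.1, a.2) ω) := by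
          exact_mod_cast Finset.subset_insert _ _
        refine ⟨w, hw, (h.mono (subset_trans ?_ h1)).trans ((Conn.of_mem ?_).trans (hc.mono h1))⟩
        · exact_mod_cast Finset.inter_subset_left
        · simp
    _ = ∑ e ∈ (S.sigma (exits G S)).image (fun a => s(a.1, a.2)),
          ind (Escapes Λ (↑(insert e ω) : Set (Sym2 V)) o) := (Finset.sum_image
          (f := fun e => ind (Escapes Λ (↑(insert e ω) : Set (Sym2 V)) o)) hinj).symm
    _ ≤ _ := by
        refine Finset.sum_le_sum_of_subset_of_nonneg ?_ fun _ _ _ => ind_nonneg _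
        intro e he
        obtain ⟨a, ha, rfl⟩ := Finset.mem_image.1 he
        simp only [Finset.mem_sigma, mem_exits] at ha
        exact (mem_edgesAt G).2 ⟨ha.2.1, Or.inl (hSΛ ha.1)⟩

/-- The first event is decided off `edgesIn G S` by `nonescaping_local`, the second inside it, so
they are independent. -/
lemma ev_nonescaping_mul {Λ S : Finset V} (hS : S ⊆ Λ) (p : Sym2 V → ℝ) (o u : V) :
    ev (edgesAt G Λ) p (fun ω => ind (∀ z, z ∈ S ↔ ¬ Escapes Λ (ω : Set (Sym2 V)) z) *
      ind (Conn (↑(ω ∩ edgesIn G S) : Set (Sym2 V)) o u)) =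
    ev (edgesAt G Λ) p (fun ω => ind (∀ z, z ∈ S ↔ ¬ Escapes Λ (ω : Set (Sym2 V)) z)) *
      tau (edgesIn G S) p o u := by
  have hsub := edgesIn_subset_edgesAt G hS
  have h1 : ∀ ω ⊆ edgesAt G Λ, ω ∩ edgesIn G S = ω \ (edgesAt G Λ \ edgesIn G S) := by
    intro ω hω; ext e
    have := @hω e
    simp only [Finset.mem_inter, Finset.mem_sdiff]; tauto
  have h2 : ∀ ω ⊆ edgesAt G Λ, ω \ edgesIn G S = ω ∩ (edgesAt G Λ \ edgesIn G S) := by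
    intro ω hω; ext e
    have := @hω e
    simp only [Finset.mem_inter, Finset.mem_sdiff]; tauto
  have h3 : tau (edgesIn G S) p o u = ev (edgesAt G Λ) p
      (fun ω => ind (Conn (↑(ω \ (edgesAt G Λ \ edgesIn G S)) : Set (Sym2 V)) o u)) := by
    rw [ev_of_local hsub]
    · refine ev_congr fun ω hω => ?_
      rw [← h1 ω (hω.trans hsub), Finset.inter_eq_left.2 hω]
    · intro ω hω
      rw [← h1 ω hω, ← h1 _ (Finset.inter_subset_left.trans hω), Finset.inter_assoc,
        Finset.inter_self]
  rw [h3, ← ev_mul_of_local Finset.sdiff_subset p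
    (fun ω => ind (Conn (ω : Set (Sym2 V)) o u))]
  · exact ev_congr fun ω hω => by rw [h1 ω hω]
  · intro ω hω
    rw [← h2 ω hω]
    exact congrArg ind (propext (nonescaping_local G Λ S ω))

/-- The differential inequality of Duminil-Copin and Tassion. -/
lemma one_sub_escapeProb_le_deriv {o : V} {q : ℝ} (hq : 0 ≤ q) (hG : ¬ Subcritical G o q)
    {s : ℝ} (hs : q ≤ s) (hs1 : s ≤ 1) {Λ : Finset V} (ho : o ∈ Λ) :
    1 - escapeProb G Λ s o ≤ ∑ e ∈ edgesAt G Λ, ev (edgesAt G Λ) (fun _ => s) (fun ω =>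
      ind (Escapes Λ (↑(insert e ω) : Set (Sym2 V)) o) -
        ind (Escapes Λ (↑(ω.erase e) : Set (Sym2 V)) o)) := by
  set F := edgesAt G Λ with hF
  have hp : IsProb (fun _ : Sym2 V => s) := isProb_const (hq.trans hs) hs1
  have hpq : IsProb (fun _ : Sym2 V => q) := isProb_const hq (hs.trans hs1)
  let N : Finset V → Finset (Sym2 V) → Prop := fun S ω =>
    ∀ z, z ∈ S ↔ ¬ Escapes Λ (ω : Set (Sym2 V)) z
  let 𝒮 := Λ.powerset.filter (o ∈ ·)
  have huniq : ∀ S S' ω, N S ω → N S' ω → S = S' := fun S S' ω h h' => by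
    ext z; rw [h z, h' z]
  -- Vertices outside `Λ` escape trivially, so the non-escaping set is a subset of `Λ`.
  have hself : ∀ ω : Finset (Sym2 V), N (Λ.filter fun z => ¬ Escapes Λ (ω : Set (Sym2 V)) z) ω := fun ω z => by
    simp only [Finset.mem_filter, and_iff_right_iff_imp]
    intro h
    by_contra hz
    exact h ⟨z, hz, Conn.refl _ _⟩
  -- The factor q ≤ 1 in `phi` is dropped, so the coefficient of 1 - θ in the differential
  -- inequality is simply 1.
  have hone : ∀ S ∈ 𝒮, 1 ≤ ∑ u ∈ S, ∑ _v ∈ exits G S u, tau (edgesIn G S) (fun _ => s) o u := by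
    intro S hS
    have h1 : 1 ≤ phi G q S o := by
      by_contra h
      exact hG ⟨S, (Finset.mem_filter.1 hS).2, not_le.1 h⟩
    refine h1.trans (Finset.sum_le_sum fun u _ => Finset.sum_le_sum fun v _ => ?_)
    exact (mul_le_of_le_one_right (tau_nonneg hpq _ _) (hs.trans hs1)).trans
      (tau_mono_prob hpq hp (fun _ => hs) _ _)
  calc 1 - escapeProb G Λ s o
      = ev F (fun _ => s) (fun ω => 1 - ind (Escapes Λ (ω : Set (Sym2 V)) o)) := by
        rw [ev_sub, ev_const]; rfl
    _ ≤ ev F (fun _ => s) (fun ω => ∑ S ∈ 𝒮, ind (N S ω)) := by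
        refine ev_mono hp fun ω _ => ?_
        by_cases h : Escapes Λ (ω : Set (Sym2 V)) o
        · rw [ind_of h, sub_self]
          exact Finset.sum_nonneg fun _ _ => ind_nonneg _
        · rw [ind_of_not h, sub_zero, ← ind_of (hself ω)]
          refine Finset.single_le_sum (f := fun S => ind (N S ω)) (fun _ _ => ind_nonneg _) ?_
          simp only [𝒮, Finset.mem_filter, Finset.mem_powerset]
          exact ⟨Finset.filter_subset _ _, ho, h⟩
    _ = ∑ S ∈ 𝒮, ev F (fun _ => s) (fun ω => ind (N S ω)) := ev_sum _ _ _ _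
    _ ≤ ∑ S ∈ 𝒮, ev F (fun _ => s) (fun ω => ind (N S ω)) *
          ∑ u ∈ S, ∑ _v ∈ exits G S u, tau (edgesIn G S) (fun _ => s) o u :=
        Finset.sum_le_sum fun S hS =>
          le_mul_of_one_le_right (ev_nonneg hp fun _ _ => ind_nonneg _) (hone S hS)
    _ = ev F (fun _ => s) (fun ω => ∑ S ∈ 𝒮, ind (N S ω) * ∑ u ∈ S, ∑ _v ∈ exits G S u,
          ind (Conn (↑(ω ∩ edgesIn G S) : Set (Sym2 V)) o u)) := by
        rw [ev_sum]
        refine Finset.sum_congr rfl fun S hS => ?_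
        simp only [Finset.mul_sum, ev_sum]
        refine Finset.sum_congr rfl fun u _ => Finset.sum_congr rfl fun v _ => ?_
        exact (ev_nonescaping_mul G
          (Finset.mem_powerset.1 (Finset.mem_filter.1 hS).1) (fun _ => s) o u).symm
    _ ≤ ev F (fun _ => s) (fun ω => ∑ e ∈ F,
          (ind (Escapes Λ (↑(insert e ω) : Set (Sym2 V)) o) -
            ind (Escapes Λ (↑(ω.erase e) : Set (Sym2 V)) o))) := by
        refine ev_mono hp fun ω _ => ?_
        have hnn : 0 ≤ ∑ e ∈ F, (ind (Escapes Λ (↑(insert e ω) : Set (Sym2 V)) o) -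
            ind (Escapes Λ (↑(ω.erase e) : Set (Sym2 V)) o)) :=
          Finset.sum_nonneg fun e _ => sub_nonneg.2 (ind_mono (Escapes.mono
            (by exact_mod_cast (Finset.erase_subset e ω).trans (Finset.subset_insert e ω))))
        by_cases hex : ∃ S ∈ 𝒮, N S ω
        · obtain ⟨S, hS, hN⟩ := hex
          rw [Finset.sum_eq_single S (fun S' _ hne => by
            rw [ind_of_not fun h => hne (huniq _ _ _ h hN), zero_mul]) (fun h => absurd hS h),
            ind_of hN, one_mul]
          simp only [𝒮, Finset.mem_filter, Finset.mem_powerset] at hS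
          exact sum_exits_le_pivotal G ((hN o).1 hS.2) hS.1 hN
        · rw [Finset.sum_eq_zero fun S hS => by
            rw [ind_of_not fun h => hex ⟨S, hS, h⟩, zero_mul]]
          exact hnn
    _ = _ := ev_sum _ _ _ _

/-- Above the threshold of subcriticality, the probability to escape from a finite set is bounded
below uniformly in the set. -/
lemma le_escapeProb {o : V} {q p : ℝ} (hq : 0 ≤ q) (hG : ¬ Subcritical G o q) (hqp : q ≤ p)
    (hp : p ≤ 1) {Λ : Finset V} (ho : o ∈ Λ) : 1 - Real.exp (q - p) ≤ escapeProb G Λ p o := by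
  -- The inequality 1 - θ ≤ θ' says that (1 - θ(s)) e^s is nonincreasing; comparing s = q with s = p
  -- gives the bound.
  let g : ℝ → ℝ := fun s => (1 - escapeProb G Λ s o) * Real.exp s
  have hd : ∀ s, HasDerivAt g ((0 - ∑ e ∈ edgesAt G Λ, ev (edgesAt G Λ) (fun _ => s) (fun ω =>
      ind (Escapes Λ (↑(insert e ω) : Set (Sym2 V)) o) -
        ind (Escapes Λ (↑(ω.erase e) : Set (Sym2 V)) o))) * Real.exp s +
      (1 - escapeProb G Λ s o) * Real.exp s) s := fun s =>
    ((hasDerivAt_const s (1 : ℝ)).sub (hasDerivAt_ev (edgesAt G Λ)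
      (fun ω => ind (Escapes Λ (ω : Set (Sym2 V)) o)) s)).mul (Real.hasDerivAt_exp s)
  have hanti : AntitoneOn g (Set.Icc q p) := by
    refine antitoneOn_of_deriv_nonpos (convex_Icc q p)
      (fun s _ => (hd s).continuousAt.continuousWithinAt)
      (fun s _ => (hd s).differentiableAt.differentiableWithinAt) fun s hs => ?_
    rw [interior_Icc] at hs
    rw [(hd s).deriv]
    have := one_sub_escapeProb_le_deriv G hq hG hs.1.le (hs.2.le.trans hp) ho
    nlinarith [Real.exp_pos s]
  have h := hanti (Set.left_mem_Icc.2 hqp) (Set.right_mem_Icc.2 hqp) hqp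
  have h0 : 0 ≤ escapeProb G Λ q o :=
    ev_nonneg (isProb_const hq (hqp.trans hp)) fun _ _ => ind_nonneg _
  have h1 : g q ≤ Real.exp q := mul_le_of_le_one_left (Real.exp_pos q).le (by linarith)
  have h2 : (1 - escapeProb G Λ p o) ≤ Real.exp (q - p) := by
    rw [Real.exp_sub, le_div_iff₀ (Real.exp_pos p)]
    exact h.trans h1
  linarith

/-- Covers p_c = 0 at the end of the proof, where no parameter lies below p_c. -/
lemma subcritical_zero (o : V) : Subcritical G o 0 :=
  ⟨{o}, by simp, by simp [phi]⟩

end Sharpness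

/-! ### Bounds on the two-point function by exploration; finite expected cluster size -/

section Susceptibility

open scoped Classical

variable {V : Type*}

lemma sum_le_sum_of_support {ι : Type*} {Z S : Finset ι} {a b : ι → ℝ}
    (h0 : ∀ u ∈ Z, u ∉ S → a u ≤ 0) (h1 : ∀ u ∈ Z, u ∈ S → a u ≤ b u) (hb : ∀ u ∈ S, 0 ≤ b u) :
    ∑ u ∈ Z, a u ≤ ∑ u ∈ S, b u := by
  calc ∑ u ∈ Z, a u ≤ ∑ u ∈ Z, if u ∈ S then b u else 0 :=
        Finset.sum_le_sum fun u hu => by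
          split_ifs with h
          · exact h1 u hu h
          · exact h0 u hu h
    _ = ∑ u ∈ Z.filter (· ∈ S), b u := (Finset.sum_filter _ _).symm
    _ ≤ ∑ u ∈ S, b u := Finset.sum_le_sum_of_subset_of_nonneg
        (fun u hu => (Finset.mem_filter.1 hu).2) fun u hu _ => hb u hu

/-- A weighted bound on connection probabilities follows from the exploration inequality. -/
lemma sum_tau_le_of_sprinkle {F : Finset (Sym2 V)} {Z : Finset V}
    (hZ : ∀ u v, s(u, v) ∈ F → v ∈ Z) {f : V → ℝ} (hf : ∀ x, 0 < f x) {p' : Sym2 V → ℝ} {C β : ℝ}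
    (hβ : β < 1)
    (H : ∀ x ∈ Z, ∃ p δ : Sym2 V → ℝ, IsProb p ∧ IsProb δ ∧
      (∀ e, 1 - (1 - p e) * (1 - δ e) = p' e) ∧ ∑ y ∈ Z, tau F p x y * f y ≤ C * f x ∧
      (∑ u ∈ Z, ∑ v ∈ Z, if s(u, v) ∈ F then tau F p x u * (δ s(u, v) * f v) else 0) ≤ β * f x)
    {x : V} (hx : x ∈ Z) : ∑ y ∈ Z, tau F p' x y * f y ≤ C / (1 - β) * f x := by
  -- Since `Z` is finite, the ratio of τf to f attains a finite maximum m. The exploration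
  -- inequality at a maximizer reads m ≤ C + β m, which can be solved for m because β < 1.
  obtain ⟨x₀, hx₀, hmax⟩ := Finset.exists_max_image Z
    (fun x => (∑ y ∈ Z, tau F p' x y * f y) / f x) ⟨x, hx⟩
  set m := (∑ y ∈ Z, tau F p' x₀ y * f y) / f x₀ with hm
  have hle : ∀ v ∈ Z, ∑ y ∈ Z, tau F p' v y * f y ≤ m * f v := fun v hv =>
    (div_le_iff₀ (hf v)).1 (hmax v hv)
  obtain ⟨p, δ, hp, hδ, hpp, h1, h2⟩ := H x₀ hx₀
  have hpe : p' = fun e => 1 - (1 - p e) * (1 - δ e) := funext fun e => (hpp e).symm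
  have hp' : IsProb p' := fun e => by
    have h1 := hp e; have h2 := hδ e
    rw [← hpp]
    constructor <;> nlinarith
  have hm0 : 0 ≤ m := div_nonneg
    (Finset.sum_nonneg fun y _ => mul_nonneg (tau_nonneg hp' _ _) (hf y).le) (hf x₀).le
  have key : m * f x₀ ≤ C * f x₀ + m * (β * f x₀) := by
    calc m * f x₀ = ∑ y ∈ Z, tau F p' x₀ y * f y := div_mul_cancel₀ _ (hf x₀).ne'
      _ ≤ ∑ y ∈ Z, (tau F p x₀ y + ∑ u ∈ Z, ∑ v ∈ Z, if s(u, v) ∈ F then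
            tau F p x₀ u * (δ s(u, v) * tau F p' v y) else 0) * f y := by
          refine Finset.sum_le_sum fun y _ => mul_le_mul_of_nonneg_right ?_ (hf y).le
          rw [hpe]
          exact tau_sprinkle_le hp hδ hZ hx₀ y
      _ = ∑ y ∈ Z, tau F p x₀ y * f y + ∑ u ∈ Z, ∑ v ∈ Z, if s(u, v) ∈ F then
            tau F p x₀ u * (δ s(u, v) * ∑ y ∈ Z, tau F p' v y * f y) else 0 := by
          simp only [add_mul, Finset.sum_add_distrib, Finset.sum_mul]
          congr 1
          rw [Finset.sum_comm]
          refine Finset.sum_congr rfl fun u _ => ?_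
          rw [Finset.sum_comm]
          refine Finset.sum_congr rfl fun v _ => ?_
          split_ifs
          · simp only [Finset.mul_sum, mul_assoc]
          · simp
      _ ≤ C * f x₀ + ∑ u ∈ Z, ∑ v ∈ Z, m * (if s(u, v) ∈ F then
            tau F p x₀ u * (δ s(u, v) * f v) else 0) := by
          refine add_le_add h1 (Finset.sum_le_sum fun u _ => Finset.sum_le_sum fun v hv => ?_)
          split_ifs
          · have := mul_le_mul_of_nonneg_left (mul_le_mul_of_nonneg_left (hle v hv)
              (hδ s(u, v)).1) (tau_nonneg (F := F) hp x₀ u)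
            linarith
          · simp
      _ ≤ _ := by
          simp only [← Finset.mul_sum]
          exact add_le_add le_rfl (mul_le_mul_of_nonneg_left h2 hm0)
  have hmC : m ≤ C / (1 - β) := by
    rw [le_div_iff₀ (by linarith)]
    have h3 : 0 ≤ (C + m * β - m) * f x₀ := by nlinarith
    have := nonneg_of_mul_nonneg_left h3 (hf x₀)
    linarith
  exact (hle x hx).trans (mul_le_mul_of_nonneg_right hmC (hf x).le)

variable (G : SimpleGraph V)

lemma map_subset_edgeSet {G : SimpleGraph V} (φ : G ≃g G) {F : Finset (Sym2 V)}
    (hF : (F : Set (Sym2 V)) ⊆ G.edgeSet) :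
    (↑(F.map φ.toEquiv.toEmbedding.sym2Map) : Set (Sym2 V)) ⊆ G.edgeSet := by
  intro e he
  simp only [Finset.coe_map, Set.mem_image, Finset.mem_coe] at he
  obtain ⟨e', he', rfl⟩ := he
  induction e' using Sym2.ind with
  | _ u v =>
    have : G.Adj u v := hF he'
    exact φ.map_adj_iff.2 this

lemma mem_map_sym2 (φ : V ≃ V) {F : Finset (Sym2 V)} {u v : V} :
    s(u, v) ∈ F.map φ.toEmbedding.sym2Map ↔ s(φ.symm u, φ.symm v) ∈ F := by
  obtain ⟨a, rfl⟩ := φ.surjective u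
  obtain ⟨b, rfl⟩ := φ.surjective v
  have : s(φ a, φ b) = φ.toEmbedding.sym2Map s(a, b) := by simp [Function.Embedding.sym2Map]
  rw [this, Finset.mem_map']
  simp

lemma edgesIn_map (φ : G ≃g G) (S : Finset V) :
    edgesIn G (S.map φ.toEquiv.toEmbedding) =
      (edgesIn G S).map φ.toEquiv.toEmbedding.sym2Map := by
  ext e
  induction e using Sym2.ind with
  | _ u v =>
    rw [mem_map_sym2, mem_edgesIn, mem_edgesIn]
    obtain ⟨a, rfl⟩ := φ.surjective u
    obtain ⟨b, rfl⟩ := φ.surjective v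
    have h1 : ∀ c, φ.toEquiv.symm (φ c) = c := fun c => φ.toEquiv.symm_apply_apply c
    have h2 : ∀ c, φ c ∈ S.map φ.toEquiv.toEmbedding ↔ c ∈ S := fun c =>
      Finset.mem_map' φ.toEquiv.toEmbedding
    rw [h1, h1, h2, h2, φ.map_adj_iff]

variable [G.LocallyFinite]

lemma exits_map (φ : G ≃g G) (S : Finset V) (u : V) :
    exits G (S.map φ.toEquiv.toEmbedding) (φ u) = (exits G S u).map φ.toEquiv.toEmbedding := by
  ext v
  obtain ⟨b, rfl⟩ := φ.surjective v
  have h2 : ∀ S : Finset V, ∀ c, φ c ∈ S.map φ.toEquiv.toEmbedding ↔ c ∈ S := fun S c =>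
    Finset.mem_map' φ.toEquiv.toEmbedding
  rw [h2, mem_exits, mem_exits, h2, φ.map_adj_iff]

/-- Lets one set around o, as in `Subcritical`, serve around every vertex of a transitive graph. -/
lemma phi_map (φ : G ≃g G) (q : ℝ) (S : Finset V) (o : V) :
    phi G q (S.map φ.toEquiv.toEmbedding) (φ o) = phi G q S o := by
  unfold phi
  rw [Finset.sum_map]
  refine Finset.sum_congr rfl fun u _ => ?_
  have h1 : φ.toEquiv.toEmbedding u = φ u := rfl
  rw [h1, exits_map, Finset.sum_map, edgesIn_map]
  exact Finset.sum_congr rfl fun v _ => by rw [← tau_map φ.toEquiv (edgesIn G S)]; rfl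

lemma edgesAt_map (φ : G ≃g G) (S : Finset V) :
    edgesAt G (S.map φ.toEquiv.toEmbedding) =
      (edgesAt G S).map φ.toEquiv.toEmbedding.sym2Map := by
  ext e
  induction e using Sym2.ind with
  | _ u v =>
    rw [mem_map_sym2, mem_edgesAt, mem_edgesAt]
    obtain ⟨a, rfl⟩ := φ.surjective u
    obtain ⟨b, rfl⟩ := φ.surjective v
    have h1 : ∀ c, φ.toEquiv.symm (φ c) = c := fun c => φ.toEquiv.symm_apply_apply c
    have h2 : ∀ c, φ c ∈ S.map φ.toEquiv.toEmbedding ↔ c ∈ S := fun c =>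
      Finset.mem_map' φ.toEquiv.toEmbedding
    rw [h1, h1, h2, h2, φ.map_adj_iff]

lemma escapeProb_map (φ : G ≃g G) (s : ℝ) (Λ : Finset V) (o : V) :
    escapeProb G (Λ.map φ.toEquiv.toEmbedding) s (φ o) = escapeProb G Λ s o := by
  unfold escapeProb
  rw [edgesAt_map, ev_image]
  refine ev_congr fun ω _ => congrArg ind (propext ?_)
  have h2 : ∀ c, φ c ∈ Λ.map φ.toEquiv.toEmbedding ↔ c ∈ Λ := fun c =>
    Finset.mem_map' φ.toEquiv.toEmbedding
  constructor
  · rintro ⟨z, hz, hc⟩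
    obtain ⟨z, rfl⟩ := φ.surjective z
    exact ⟨z, fun h => hz ((h2 z).2 h), (conn_map φ.toEquiv ω o z).1 hc⟩
  · rintro ⟨z, hz, hc⟩
    exact ⟨φ z, fun h => hz ((h2 z).1 h), (conn_map φ.toEquiv ω o z).2 hc⟩

/-- The vertices touched by `F`. -/
lemma exists_vertexSet (F : Finset (Sym2 V)) (Z₀ : Finset V) :
    ∃ Z : Finset V, Z₀ ⊆ Z ∧ ∀ u v, s(u, v) ∈ F → v ∈ Z :=
  ⟨Z₀ ∪ F.biUnion fun e => e.toFinset, Finset.subset_union_left, fun u v h =>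
    Finset.mem_union_right _ (Finset.mem_biUnion.2 ⟨_, h, by simp⟩)⟩

/-- In a transitive graph, the expected cluster size is finite in the subcritical regime. -/
lemma exists_sum_tau_le (htrans : ∀ x y : V, ∃ φ : G ≃g G, φ x = y) {o : V} {q : ℝ} (hq0 : 0 ≤ q)
    (hq1 : q ≤ 1) (h : Subcritical G o q) :
    ∃ M : ℝ, ∀ (F : Finset (Sym2 V)), (F : Set (Sym2 V)) ⊆ G.edgeSet → ∀ (x : V) (Z : Finset V),
      ∑ y ∈ Z, tau F (fun _ => q) x y ≤ M := by
  obtain ⟨S₀, ho, hS₀⟩ := h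
  refine ⟨(S₀.card : ℝ) / (1 - phi G q S₀ o), fun F hF x Z₀ => ?_⟩
  have hpq : IsProb (fun _ : Sym2 V => q) := isProb_const hq0 hq1
  obtain ⟨Z, hZ₀, hZ⟩ := exists_vertexSet F (insert x Z₀)
  have hx : x ∈ Z := hZ₀ (Finset.mem_insert_self _ _)
  have main := sum_tau_le_of_sprinkle hZ (f := fun _ => 1) (fun _ => one_pos)
    (p' := fun _ => q) (C := S₀.card) hS₀ ?_ hx
  · simp only [mul_one] at main
    exact (Finset.sum_le_sum_of_subset_of_nonneg ((Finset.subset_insert _ _).trans hZ₀)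
      fun _ _ _ => tau_nonneg hpq _ _).trans main
  intro x _
  obtain ⟨φ, rfl⟩ := htrans o x
  set S := S₀.map φ.toEquiv.toEmbedding with hS
  have hoS : φ o ∈ S := (Finset.mem_map' φ.toEquiv.toEmbedding).2 ho
  have hcard : (S₀.card : ℝ) = S.card := by rw [hS, Finset.card_map]
  have hphi : phi G q S₀ o = phi G q S (φ o) := (phi_map G φ q S₀ o).symm
  -- The edges inside the translate `S` are revealed first, and all others are sprinkled at full
  -- density q. The first-stage cluster stays in `S`, whence the constant |S|, and the sprinkled
  -- exits contribute at most `phi`.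
  let p : Sym2 V → ℝ := fun e => if e ∈ edgesIn G S then q else 0
  let δ : Sym2 V → ℝ := fun e => if e ∈ edgesIn G S then 0 else q
  have hp : IsProb p := fun e => by
    simp only [p]; split_ifs
    · exact ⟨hq0, hq1⟩
    · norm_num
  have hδ : IsProb δ := fun e => by
    simp only [δ]; split_ifs
    · norm_num
    · exact ⟨hq0, hq1⟩
  have htau : ∀ u, tau F p (φ o) u ≤ tau (edgesIn G S) (fun _ => q) (φ o) u := by
    intro u
    have h1 : tau F p (φ o) u = tau (F ∩ edgesIn G S) p (φ o) u := by
      refine ev_eq_of_zero_off Finset.inter_subset_left (fun e he => if_neg fun h => ?_) _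
      simp only [Finset.mem_sdiff, Finset.mem_inter, not_and] at he
      exact he.2 he.1 h
    have h2 : tau (F ∩ edgesIn G S) p (φ o) u = tau (F ∩ edgesIn G S) (fun _ => q) (φ o) u :=
      ev_congr_prob _ fun e he => if_pos (Finset.mem_inter.1 he).2
    rw [h1, h2]
    exact tau_mono_set Finset.inter_subset_right hpq _ _
  have htau0 : ∀ u, u ∉ S → tau F p (φ o) u ≤ 0 := by
    intro u hu
    refine (htau u).trans_eq (tau_eq_zero (Z := S) (fun a b hab => ?_)
      (fun h => hu (h ▸ hoS)) hu)
    exact ((mem_edgesIn G).1 hab).2.1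
  refine ⟨p, δ, hp, hδ, fun e => ?_, ?_, ?_⟩
  · simp only [p, δ]; split_ifs <;> ring
  · rw [hcard, Finset.cast_card, mul_one]
    exact sum_le_sum_of_support (fun u _ hu => by simpa using htau0 u hu)
      (fun u _ _ => by simpa using tau_le_one hp _ _) fun _ _ => zero_le_one
  · rw [hphi, mul_one]
    unfold phi
    have hq' : ∀ u, 0 ≤ tau (edgesIn G S) (fun _ => q) (φ o) u * q := fun u =>
      mul_nonneg (tau_nonneg hpq _ _) hq0
    refine sum_le_sum_of_support (fun u _ hu => ?_) (fun u _ hu => ?_)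
      fun u _ => Finset.sum_nonneg fun v _ => hq' u
    · refine Finset.sum_nonpos fun v _ => ?_
      split_ifs
      · exact mul_nonpos_of_nonpos_of_nonneg (htau0 u hu) (by simpa using (hδ _).1)
      · exact le_rfl
    · refine sum_le_sum_of_support (fun v _ hv => ?_) (fun v _ hv => ?_) fun v _ => hq' u
      · split_ifs with huv
        · have : s(u, v) ∈ edgesIn G S := by
            have hadj : G.Adj u v := hF huv
            refine (mem_edgesIn G).2 ⟨hu, ?_, hadj⟩
            by_contra hc
            exact hv ((mem_exits G).2 ⟨hadj, hc⟩)
          simp [δ, this]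
        · exact le_rfl
      · split_ifs with huv
        · rw [mul_one]
          refine mul_le_mul (htau u) ?_ (hδ _).1 (tau_nonneg hpq _ _)
          simp only [δ]; split_ifs
          · exact hq0
          · exact le_rfl
        · exact hq' u

end Susceptibility

/-! ### From finite edge sets to the percolation measure -/

section InfiniteVolume

open scoped Classical

variable {V : Type*} (G : SimpleGraph V)

instance (p : I) : IsProbabilityMeasure (bondPercolation G p) := by
  unfold bondPercolation; infer_instance

/-- The open edges within `F`. -/
noncomputable def restrictTo (F : Finset (Sym2 V)) (ω : Set (Sym2 V)) : Finset (Sym2 V) :=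
  F.filter (· ∈ ω)

lemma restrictTo_subset (F : Finset (Sym2 V)) (ω : Set (Sym2 V)) : restrictTo F ω ⊆ F :=
  Finset.filter_subset _ _

lemma coe_restrictTo (F : Finset (Sym2 V)) (ω : Set (Sym2 V)) :
    (restrictTo F ω : Set (Sym2 V)) = ↑F ∩ ω := by
  ext; simp [restrictTo]

lemma restrictTo_eq_iff {F A : Finset (Sym2 V)} (hA : A ⊆ F) (ω : Set (Sym2 V)) :
    restrictTo F ω = A ↔ ∀ e ∈ F, (e ∈ ω ↔ e ∈ A) := by
  constructor
  · rintro rfl e he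
    simp [restrictTo, he]
  · intro h
    ext e
    simp only [restrictTo, Finset.mem_filter]
    exact ⟨fun H => (h e H.1).1 H.2, fun H => ⟨hA H, (h e (hA H)).2 H⟩⟩

lemma measurableSet_restrictTo_eq {F A : Finset (Sym2 V)} (hA : A ⊆ F) :
    MeasurableSet {ω : Set (Sym2 V) | restrictTo F ω = A} := by
  have : {ω : Set (Sym2 V) | restrictTo F ω = A} =
      ⋂ e ∈ F, {ω : Set (Sym2 V) | e ∈ ω ↔ e ∈ A} := by
    ext ω
    simpa using restrictTo_eq_iff hA ω
  rw [this]
  refine Finset.measurableSet_biInter _ fun e _ => ?_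
  exact (measurable_set_mem e) (MeasurableSet.of_discrete (s := {P : Prop | P ↔ e ∈ A}))

lemma setOf_restrictTo (F : Finset (Sym2 V)) (P : Finset (Sym2 V) → Prop) :
    {ω : Set (Sym2 V) | P (restrictTo F ω)} =
      ⋃ A ∈ F.powerset.filter P, {ω : Set (Sym2 V) | restrictTo F ω = A} := by
  ext ω
  simp only [Set.mem_iUnion, Finset.mem_filter, Finset.mem_powerset, Set.mem_ofPred_eq]
  constructor
  · exact fun h => ⟨_, ⟨restrictTo_subset F ω, h⟩, rfl⟩
  · rintro ⟨A, ⟨_, hA⟩, rfl⟩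
    exact hA

lemma measurableSet_restrictTo (F : Finset (Sym2 V)) (P : Finset (Sym2 V) → Prop) :
    MeasurableSet {ω : Set (Sym2 V) | P (restrictTo F ω)} := by
  rw [setOf_restrictTo]
  exact Finset.measurableSet_biUnion _ fun A hA => measurableSet_restrictTo_eq
    (Finset.mem_powerset.1 (Finset.mem_filter.1 hA).1)

lemma bondPercolation_restrictTo_eq (p : I) {F A : Finset (Sym2 V)}
    (hF : (F : Set (Sym2 V)) ⊆ G.edgeSet) (hA : A ⊆ F) :
    (bondPercolation G p).real {ω | restrictTo F ω = A} =
      ∏ e ∈ F, if e ∈ A then (p : ℝ) else 1 - p := by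
  have hpre : (fun P : Sym2 V → Prop => {e | P e}) ⁻¹' {ω | restrictTo F ω = A} =
      Set.pi F (fun e => {P : Prop | P ↔ e ∈ A}) := by
    ext P
    simp only [Set.mem_preimage, Set.mem_ofPred_eq, restrictTo_eq_iff hA, Set.mem_pi,
      Finset.mem_coe]
  rw [measureReal_def, bondPercolation, setBernoulli_apply', hpre,
    Measure.infinitePi_pi _ (fun _ _ => MeasurableSet.of_discrete), ENNReal.toReal_prod]
  refine Finset.prod_congr rfl fun e he => ?_
  have heG : (e ∈ G.edgeSet) = True := eq_true (hF he)
  rw [heG]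
  by_cases h : e ∈ A <;> simp [h]

/-- The bridge between the product measure and finite expectations. `F` must consist of edges of G,
because other pairs are almost surely closed. -/
lemma bondPercolation_restrictTo (p : I) {F : Finset (Sym2 V)}
    (hF : (F : Set (Sym2 V)) ⊆ G.edgeSet) (P : Finset (Sym2 V) → Prop) :
    (bondPercolation G p).real {ω | P (restrictTo F ω)} =
      ev F (fun _ => (p : ℝ)) (fun ω => ind (P ω)) := by
  rw [setOf_restrictTo, measureReal_biUnion_finset]
  · rw [Finset.sum_filter]
    refine Finset.sum_congr rfl fun A hA => ?_
    beta_reduce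
    by_cases h : P A
    · rw [if_pos h, ind_of h, mul_one,
        bondPercolation_restrictTo_eq G p hF (Finset.mem_powerset.1 hA)]
    · rw [if_neg h, ind_of_not h, mul_zero]
  · intro A _ B _ hAB
    refine Set.disjoint_left.2 fun ω (h1 : restrictTo F ω = A) (h2 : restrictTo F ω = B) => ?_
    exact hAB (h1.symm.trans h2)
  · exact fun A hA => measurableSet_restrictTo_eq
      (Finset.mem_powerset.1 (Finset.mem_filter.1 hA).1)

lemma Conn.exists_finset {ω : Set (Sym2 V)} {x y : V} (h : Conn ω x y) :
    ∃ F : Finset (Sym2 V), (F : Set (Sym2 V)) ⊆ ω ∧ Conn (F : Set (Sym2 V)) x y := by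
  refine Conn.induction (P := fun y => ∃ F : Finset (Sym2 V), (F : Set (Sym2 V)) ⊆ ω ∧
    Conn (F : Set (Sym2 V)) x y) ⟨∅, by simp, Conn.refl _ _⟩ ?_ h
  rintro u v _ huv ⟨F, hF, hc⟩
  refine ⟨insert s(u, v) F, ?_, (hc.mono ?_).trans (Conn.of_mem ?_)⟩
  · rw [Finset.coe_insert]
    exact Set.insert_subset huv hF
  · exact_mod_cast Finset.subset_insert _ _
  · simp

/-- The open cluster of `x` is infinite. -/
def InfAt (x : V) (ω : Set (Sym2 V)) : Prop := {z | Conn (G.edgeSet ∩ ω) x z}.Infinite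

lemma infAt_iff (x : V) (ω : Set (Sym2 V)) :
    InfAt G x ω ↔ ∀ Λ : Finset V, Escapes Λ (G.edgeSet ∩ ω) x := by
  constructor
  · intro h Λ
    by_contra hc
    refine h (Λ.finite_toSet.subset fun z hz => ?_)
    by_contra hzΛ
    exact hc ⟨z, hzΛ, hz⟩
  · intro h hfin
    obtain ⟨z, hz, hc⟩ := h hfin.toFinset
    exact hz (by simpa using hc)

lemma infAt_iff_supp (x : V) (ω : Set (Sym2 V)) :
    InfAt G x ω ↔ ((openSubgraph G ω).connectedComponentMk x).supp.Infinite := by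
  have : {z | Conn (G.edgeSet ∩ ω) x z} = ((openSubgraph G ω).connectedComponentMk x).supp := by
    ext z
    simp only [Set.mem_ofPred_eq, SimpleGraph.ConnectedComponent.mem_supp_iff,
      SimpleGraph.ConnectedComponent.eq]
    exact ⟨Conn.symm, Conn.symm⟩
  rw [InfAt, this]

lemma hasInfiniteCluster_iff (ω : Set (Sym2 V)) :
    HasInfiniteCluster G ω ↔ ∃ x, InfAt G x ω := by
  constructor
  · rintro ⟨C, hC⟩
    induction C using SimpleGraph.ConnectedComponent.ind with
    | _ x => exact ⟨x, (infAt_iff_supp G x ω).2 hC⟩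
  · rintro ⟨x, hx⟩
    exact ⟨_, (infAt_iff_supp G x ω).1 hx⟩

lemma HasUniqueInfiniteCluster.conn {ω : Set (Sym2 V)} (h : HasUniqueInfiniteCluster G ω)
    {x y : V} (hx : InfAt G x ω) (hy : InfAt G y ω) : Conn (G.edgeSet ∩ ω) x y :=
  SimpleGraph.ConnectedComponent.eq.1
    (h.unique ((infAt_iff_supp G x ω).1 hx) ((infAt_iff_supp G y ω).1 hy))

lemma HasUniqueInfiniteCluster.hasInfiniteCluster {ω : Set (Sym2 V)}
    (h : HasUniqueInfiniteCluster G ω) : HasInfiniteCluster G ω := h.exists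

/-- Closing finitely many edges does not destroy all the infinite clusters. -/
lemma hasInfiniteCluster_sdiff (ω : Set (Sym2 V)) (F : Finset (Sym2 V)) :
    HasInfiniteCluster G (ω \ F) ↔ HasInfiniteCluster G ω := by
  rw [hasInfiniteCluster_iff, hasInfiniteCluster_iff]
  constructor
  · rintro ⟨x, hx⟩
    exact ⟨x, hx.mono fun z hz => Conn.mono (Set.inter_subset_inter_right _ Set.sdiff_subset) hz⟩
  · rintro ⟨x, hx⟩
    by_contra! hc
    obtain ⟨Z, hxZ, hZ⟩ := exists_vertexSet F {x}
    -- The cluster of x is covered by the clusters, after closing `F`, of x and of the ends of edges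
    -- of `F`. Finitely many finite sets cannot cover it.
    refine hx ((Z.finite_toSet.biUnion fun u _ => Set.not_infinite.1 (hc u)).subset fun z hz => ?_)
    simp only [Set.mem_iUnion, Finset.mem_coe, Set.mem_ofPred_eq, exists_prop]
    refine Conn.induction (P := fun z => ∃ u ∈ Z, Conn (G.edgeSet ∩ (ω \ F)) u z)
      ⟨x, hxZ (Finset.mem_singleton_self x), Conn.refl _ _⟩ ?_ hz
    rintro u v _ huv ⟨a, ha, hau⟩
    by_cases hF : s(u, v) ∈ F
    · exact ⟨v, hZ u v hF, Conn.refl _ _⟩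
    · exact ⟨a, ha, hau.trans (Conn.of_mem ⟨huv.1, huv.2, hF⟩)⟩

lemma iIndep_edges (p : I) :
    iIndep (fun e : Sym2 V => MeasurableSpace.comap (fun ω : Set (Sym2 V) => e ∈ ω) ⊤)
      (bondPercolation G p) := by
  change iIndepFun (fun (e : Sym2 V) (ω : Set (Sym2 V)) => e ∈ ω) (bondPercolation G p)
  have hmeas : Measurable fun P : Sym2 V → Prop => {e | P e} :=
    measurable_set_iff.2 fun e => measurable_pi_apply e
  have h := iIndepFun_infinitePi (ι := Sym2 V) (Ω := fun _ => Prop) (𝓧 := fun _ => Prop)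
    (P := fun e => toNNReal p • Measure.dirac (e ∈ G.edgeSet) + toNNReal (σ p) • Measure.dirac False)
    (X := fun _ P => P) (fun _ => measurable_id)
  rw [iIndepFun_iff_measure_inter_preimage_eq_mul] at h ⊢
  intro S sets hsets
  rw [bondPercolation, setBernoulli_eq_map, Measure.map_apply hmeas]
  · rw [Set.preimage_iInter₂]
    refine (h S hsets).trans (Finset.prod_congr rfl fun e he => ?_)
    rw [Measure.map_apply hmeas ((measurable_set_mem e) (hsets e he))]
    rfl
  · exact Finset.measurableSet_biInter _ fun e he => (measurable_set_mem e) (hsets e he)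

/-- The event at ω equals the event at ω \ F, and the latter configuration is measurable for any
σ-algebra that knows the edges off `F`. With `iIndep_edges` this is the input to Kolmogorov's
zero-one law. -/
lemma measurableSet_tail
    (hmeas : MeasurableSet {ω : Set (Sym2 V) | HasInfiniteCluster G ω})
    {m : MeasurableSpace (Set (Sym2 V))} {F : Finset (Sym2 V)}
    (hm : ∀ e ∉ F, MeasurableSpace.comap (fun ω : Set (Sym2 V) => e ∈ ω) ⊤ ≤ m) :
    MeasurableSet[m] {ω : Set (Sym2 V) | HasInfiniteCluster G ω} := by
  have h1 : {ω : Set (Sym2 V) | HasInfiniteCluster G ω} =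
      (fun ω : Set (Sym2 V) => ω \ F) ⁻¹' {ω : Set (Sym2 V) | HasInfiniteCluster G ω} := by
    ext ω
    exact (hasInfiniteCluster_sdiff G ω F).symm
  have h2 : @Measurable (Set (Sym2 V)) (Set (Sym2 V)) m Set.instMeasurableSpace (fun ω => ω \ F) := by
    refine (@measurable_set_iff _ _ m _).2 fun e => ?_
    by_cases he : e ∈ F
    · simp [he]
    · have h3 : (fun ω : Set (Sym2 V) => e ∈ ω \ (F : Set (Sym2 V))) = fun ω => e ∈ ω := by
        ext ω; simp [he]
      rw [h3]
      exact measurable_iff_comap_le.2 (hm e he)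
  rw [h1]
  exact h2 hmeas

/-- Connection probabilities are bounded by those in finite edge sets. -/
lemma sum_conn_le [Countable V] {p : I} {W : Finset V} {B : ℝ}
    (H : ∀ F : Finset (Sym2 V), (F : Set (Sym2 V)) ⊆ G.edgeSet →
      ∑ x ∈ W, ∑ y ∈ W, tau F (fun _ => (p : ℝ)) x y ≤ B) :
    ∑ x ∈ W, ∑ y ∈ W, (bondPercolation G p).real {ω | Conn (G.edgeSet ∩ ω) x y} ≤ B := by
  -- A connection uses finitely many edges, so it is the increasing union, over the directed set of
  -- finite edge sets, of connections within them; continuity from below applies.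
  let J := {F : Finset (Sym2 V) // (F : Set (Sym2 V)) ⊆ G.edgeSet}
  have : Nonempty J := ⟨⟨∅, by simp⟩⟩
  have : IsDirectedOrder J := ⟨fun a b => ⟨⟨a.1 ∪ b.1, by
    rw [Finset.coe_union]; exact Set.union_subset a.2 b.2⟩,
      show a.1 ≤ a.1 ∪ b.1 from Finset.subset_union_left,
      show b.1 ≤ a.1 ∪ b.1 from Finset.subset_union_right⟩⟩
  have hlim : ∀ x y, Filter.Tendsto (fun F : J => tau F.1 (fun _ => (p : ℝ)) x y) Filter.atTop
      (nhds ((bondPercolation G p).real {ω | Conn (G.edgeSet ∩ ω) x y})) := by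
    intro x y
    let s : J → Set (Set (Sym2 V)) := fun F =>
      {ω | Conn (restrictTo F.1 ω : Set (Sym2 V)) x y}
    have hmono : Monotone s := fun F F' hFF' ω hω => by
      refine Conn.mono ?_ hω
      rw [coe_restrictTo, coe_restrictTo]
      exact Set.inter_subset_inter_left _ (by exact_mod_cast hFF')
    have hU : {ω | Conn (G.edgeSet ∩ ω) x y} = ⋃ F, s F := by
      ext ω
      simp only [Set.mem_iUnion, Set.mem_ofPred_eq, s, coe_restrictTo]
      constructor
      · intro h
        obtain ⟨F, hF, hc⟩ := h.exists_finset
        refine ⟨⟨F, fun e he => (hF he).1⟩, Conn.mono ?_ hc⟩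
        exact fun e he => ⟨he, (hF he).2⟩
      · rintro ⟨F, hF⟩
        refine Conn.mono ?_ hF
        exact fun e he => ⟨F.2 he.1, he.2⟩
    have h1 := tendsto_measure_iUnion_atTop (μ := bondPercolation G p) hmono
    rw [← hU] at h1
    have h2 := (ENNReal.tendsto_toReal (measure_ne_top _ _)).comp h1
    refine h2.congr fun F => ?_
    exact bondPercolation_restrictTo G p F.2 fun ω => Conn (ω : Set (Sym2 V)) x y
  exact le_of_tendsto (tendsto_finsetSum _ fun x _ => tendsto_finsetSum _ fun y _ => hlim x y)
    (Filter.Eventually.of_forall fun F => H F.1 F.2)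

lemma setOf_infAt (x : V) : {ω : Set (Sym2 V) | InfAt G x ω} =
    ⋂ Λ : Finset V, {ω | Escapes Λ (G.edgeSet ∩ ω) x} := by
  ext ω
  simp [infAt_iff]

section LocallyFinite

variable [G.LocallyFinite]

lemma edgesAt_subset (Λ : Finset V) : (edgesAt G Λ : Set (Sym2 V)) ⊆ G.edgeSet := fun e => by
  induction e using Sym2.ind with
  | _ u v => exact fun h => ((mem_edgesAt G).1 (Finset.mem_coe.1 h)).1

/-- Up to its first vertex outside `Λ`, a path uses only edges with an end in `Λ`, so escaping is
decided by finitely many edges. -/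
lemma escapes_iff (Λ : Finset V) (ω : Set (Sym2 V)) (x : V) :
    Escapes Λ (G.edgeSet ∩ ω) x ↔ Escapes Λ (restrictTo (edgesAt G Λ) ω : Set (Sym2 V)) x := by
  rw [coe_restrictTo]
  constructor
  · rintro ⟨z, hz, hc⟩
    have : Escapes Λ (↑(edgesAt G Λ) ∩ ω) x ∨ Conn (↑(edgesAt G Λ) ∩ ω) x z := by
      refine Conn.induction (P := fun z => Escapes Λ (↑(edgesAt G Λ) ∩ ω) x ∨
        Conn (↑(edgesAt G Λ) ∩ ω) x z) (Or.inr (Conn.refl _ _)) ?_ hc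
      rintro u v _ huv (h | h)
      · exact Or.inl h
      · by_cases hu : u ∈ Λ
        · exact Or.inr (h.trans (Conn.of_mem ⟨(mem_edgesAt G).2 ⟨huv.1, Or.inl hu⟩, huv.2⟩))
        · exact Or.inl ⟨u, hu, h⟩
    rcases this with h | h
    · exact h
    · exact ⟨z, hz, h⟩
  · exact Escapes.mono (Set.inter_subset_inter_left _ (edgesAt_subset G Λ))

lemma bondPercolation_escapes (p : I) (Λ : Finset V) (x : V) :
    (bondPercolation G p).real {ω | Escapes Λ (G.edgeSet ∩ ω) x} = escapeProb G Λ p x := by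
  simp only [escapes_iff]
  exact bondPercolation_restrictTo G p (edgesAt_subset G Λ)
    fun ω => Escapes Λ (ω : Set (Sym2 V)) x

lemma measurableSet_escapes (Λ : Finset V) (x : V) :
    MeasurableSet {ω : Set (Sym2 V) | Escapes Λ (G.edgeSet ∩ ω) x} := by
  simp only [escapes_iff]
  exact measurableSet_restrictTo _ fun ω : Finset (Sym2 V) => Escapes Λ (ω : Set (Sym2 V)) x

lemma measurableSet_infAt [Countable V] (x : V) : MeasurableSet {ω : Set (Sym2 V) | InfAt G x ω} := by
  rw [setOf_infAt]
  exact MeasurableSet.iInter fun Λ => measurableSet_escapes G Λ x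

lemma measurableSet_hasInfiniteCluster [Countable V] :
    MeasurableSet {ω : Set (Sym2 V) | HasInfiniteCluster G ω} := by
  have : {ω : Set (Sym2 V) | HasInfiniteCluster G ω} = ⋃ x, {ω | InfAt G x ω} := by
    ext ω
    simp [hasInfiniteCluster_iff]
  rw [this]
  exact MeasurableSet.iUnion (measurableSet_infAt G)

lemma infAt_le_escapeProb (p : I) (x : V) (Λ : Finset V) :
    (bondPercolation G p).real {ω | InfAt G x ω} ≤ escapeProb G Λ p x := by
  rw [← bondPercolation_escapes]
  exact measureReal_mono fun ω hω => (infAt_iff G x ω).1 hω Λ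

/-- Continuity from above along growing `Λ`; `Λ₀` restricts the bound to sets that are large enough,
for instance those containing x. -/
lemma le_infAt [Countable V] {p : I} {x : V} {c : ℝ} (Λ₀ : Finset V)
    (H : ∀ Λ : Finset V, Λ₀ ⊆ Λ → c ≤ escapeProb G Λ p x) :
    c ≤ (bondPercolation G p).real {ω | InfAt G x ω} := by
  have hanti : Antitone fun Λ : Finset V => {ω : Set (Sym2 V) | Escapes Λ (G.edgeSet ∩ ω) x} := by
    rintro Λ Λ' h ω ⟨z, hz, hc⟩
    exact ⟨z, fun hz' => hz (h hz'), hc⟩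
  have h1 := tendsto_measure_iInter_atTop (μ := bondPercolation G p)
    (fun Λ => (measurableSet_escapes G Λ x).nullMeasurableSet) hanti ⟨∅, measure_ne_top _ _⟩
  rw [← setOf_infAt] at h1
  have h2 := (ENNReal.tendsto_toReal (measure_ne_top _ _)).comp h1
  refine ge_of_tendsto h2 ((Filter.eventually_ge_atTop Λ₀).mono fun Λ hΛ => ?_)
  exact (H Λ hΛ).trans_eq (bondPercolation_escapes G p Λ x).symm

/-- The existence of an infinite cluster has probability zero or one. -/
lemma hasInfiniteCluster_zero_one [Countable V] (p : I) :
    bondPercolation G p {ω | HasInfiniteCluster G ω} = 0 ∨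
      bondPercolation G p {ω | HasInfiniteCluster G ω} = 1 := by
  refine measure_zero_or_one_of_measurableSet_limsup (p := Set.Finite) (f := Filter.cofinite)
    (ns := fun F : Finset (Sym2 V) => (F : Set (Sym2 V)))
    (fun e => (measurable_set_mem e).comap_le) (iIndep_edges G p)
    (fun t ht => ht.compl_mem_cofinite) ?_ (fun F => F.finite_toSet) (fun e => ⟨{e}, by simp⟩) ?_
  · exact fun A B => ⟨A ∪ B, by simp, by simp⟩
  · rw [Filter.limsup_eq, MeasurableSpace.measurableSet_sInf]
    intro m hm
    have hfin : {e | ¬ MeasurableSpace.comap (fun ω : Set (Sym2 V) => e ∈ ω) ⊤ ≤ m}.Finite := hm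
    refine measurableSet_tail G (measurableSet_hasInfiniteCluster G) (F := hfin.toFinset)
      (fun e he => ?_)
    simpa using he

/-- Above the threshold of subcriticality there is an infinite cluster. -/
lemma pc_le_of_not_subcritical [Countable V] {o : V} {q p : I} (h : ¬ Subcritical G o q) (hqp : q < p) :
    pc G ≤ p := by
  have hqp' : (q : ℝ) < p := hqp
  have hc : 0 < 1 - Real.exp ((q : ℝ) - p) := by
    have : Real.exp ((q : ℝ) - p) < 1 := Real.exp_lt_one_iff.2 (by linarith)
    linarith
  have h1 : 1 - Real.exp ((q : ℝ) - p) ≤ (bondPercolation G p).real {ω | InfAt G o ω} :=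
    le_infAt G {o} fun Λ hΛ => le_escapeProb G q.2.1 h hqp'.le p.2.2 (Finset.singleton_subset_iff.1 hΛ)
  have h2 : (bondPercolation G p).real {ω | InfAt G o ω} ≤
      (bondPercolation G p).real {ω | HasInfiniteCluster G ω} :=
    measureReal_mono fun ω hω => (hasInfiniteCluster_iff G ω).2 ⟨o, hω⟩
  refine sInf_le ?_
  rcases hasInfiniteCluster_zero_one G p with h0 | h0
  · rw [measureReal_def (s := {ω | HasInfiniteCluster G ω}), h0] at h2
    simp only [ENNReal.toReal_zero] at h2
    linarith
  · exact (prob_compl_eq_zero_iff (measurableSet_hasInfiniteCluster G)).2 h0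

/-- If the infinite cluster is unique, the connection probabilities are large on average. -/
lemma not_unique_of_sum_tau_le [Countable V] [Infinite V]
    (htrans : ∀ x y : V, ∃ φ : G ≃g G, φ x = y) {p : I} {M : ℝ}
    (H : ∀ F : Finset (Sym2 V), (F : Set (Sym2 V)) ⊆ G.edgeSet → ∀ W : Finset V,
      ∑ x ∈ W, ∑ y ∈ W, tau F (fun _ => (p : ℝ)) x y ≤ M * W.card) :
    ¬ ∀ᵐ ω ∂(bondPercolation G p), HasUniqueInfiniteCluster G ω := by
  intro hu
  set μ := bondPercolation G p with hμ
  -- Otherwise, by countability, almost surely no vertex would be in an infinite cluster.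
  obtain ⟨o, ho⟩ : ∃ o, 0 < μ.real {ω | InfAt G o ω} := by
    by_contra! hc
    have h0 : ∀ x, μ {ω | InfAt G x ω} = 0 := fun x => by
      have := le_antisymm (hc x) measureReal_nonneg
      rwa [measureReal_eq_zero_iff] at this
    have h1 : ∀ᵐ ω ∂μ, ∀ x, ¬ InfAt G x ω := by
      rw [ae_all_iff]
      intro x
      simpa [ae_iff] using h0 x
    obtain ⟨ω, hω1, hω2⟩ := (h1.and hu).exists
    obtain ⟨x, hx⟩ := (hasInfiniteCluster_iff G ω).1 (hω2.hasInfiniteCluster)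
    exact hω1 x hx
  set θ := μ.real {ω | InfAt G o ω} with hθ
  have hθx : ∀ x, θ ≤ μ.real {ω | InfAt G x ω} := by
    intro x
    refine le_infAt G ∅ fun Λ _ => ?_
    obtain ⟨φ, hφ⟩ := htrans x o
    rw [← escapeProb_map G φ, hφ]
    exact infAt_le_escapeProb G p o _
  have hW : ∀ W : Finset V, (θ * W.card) ^ 2 ≤ M * W.card := by
    intro W
    let A : V → Set (Set (Sym2 V)) := fun x => {ω | InfAt G x ω}
    have hA : ∀ x, MeasurableSet (A x) := measurableSet_infAt G
    -- `X` counts the vertices of `W` in infinite clusters. Its second moment dominates the square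
    -- of its mean, and under uniqueness any two counted vertices are connected.
    let X : Set (Sym2 V) → ℝ := fun ω => ∑ x ∈ W, (A x).indicator 1 ω
    have hint : ∀ s : Set (Set (Sym2 V)), MeasurableSet s →
        Integrable (s.indicator (1 : Set (Sym2 V) → ℝ)) μ :=
      fun s hs => (integrable_const (1 : ℝ)).indicator hs
    have hX1 : ∫ ω, X ω ∂μ = ∑ x ∈ W, μ.real (A x) := by
      rw [integral_finsetSum _ fun x _ => hint _ (hA x)]
      exact Finset.sum_congr rfl fun x _ => integral_indicator_one (hA x)
    have hXX : ∀ ω, X ω ^ 2 = ∑ x ∈ W, ∑ y ∈ W, (A x ∩ A y).indicator (1 : Set (Sym2 V) → ℝ) ω := by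
      intro ω
      simp only [X, sq, Finset.sum_mul_sum, Set.inter_indicator_one, Pi.mul_apply]
    have hX2 : ∫ ω, X ω ^ 2 ∂μ = ∑ x ∈ W, ∑ y ∈ W, μ.real (A x ∩ A y) := by
      simp only [hXX]
      rw [integral_finsetSum _ fun x _ => integrable_finsetSum _ fun y _ =>
        hint _ ((hA x).inter (hA y))]
      refine Finset.sum_congr rfl fun x _ => ?_
      rw [integral_finsetSum _ fun y _ => hint _ ((hA x).inter (hA y))]
      exact Finset.sum_congr rfl fun y _ => integral_indicator_one ((hA x).inter (hA y))
    have hXi : Integrable X μ := integrable_finsetSum _ fun x _ => hint _ (hA x)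
    have hX2i : Integrable (fun ω => X ω ^ 2) μ := by
      simp only [hXX]
      exact integrable_finsetSum _ fun x _ => integrable_finsetSum _ fun y _ =>
        hint _ ((hA x).inter (hA y))
    set c := ∑ x ∈ W, μ.real (A x) with hc
    have hvar : c ^ 2 ≤ ∫ ω, X ω ^ 2 ∂μ := by
      have h0 : 0 ≤ ∫ ω, (X ω ^ 2 - 2 * c * X ω) + c ^ 2 ∂μ :=
        integral_nonneg fun ω => by
          have := sq_nonneg (X ω - c)
          simp only [Pi.zero_apply]
          linarith
      have h1 : ∫ ω, (X ω ^ 2 - 2 * c * X ω) + c ^ 2 ∂μ =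
          ∫ ω, (X ω ^ 2 - 2 * c * X ω) ∂μ + ∫ _, c ^ 2 ∂μ :=
        integral_add (hX2i.sub (hXi.const_mul _)) (integrable_const _)
      have h2 : ∫ ω, (X ω ^ 2 - 2 * c * X ω) ∂μ = ∫ ω, X ω ^ 2 ∂μ - ∫ ω, 2 * c * X ω ∂μ :=
        integral_sub hX2i (hXi.const_mul _)
      rw [h1, h2, integral_const_mul, hX1] at h0
      simp only [integral_const, probReal_univ, smul_eq_mul, one_mul] at h0
      linarith
    have hcθ : θ * W.card ≤ c := by
      rw [hc, mul_comm, ← nsmul_eq_mul]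
      exact Finset.card_nsmul_le_sum _ _ _ fun x _ => hθx x
    have hconn : ∀ x y, μ.real (A x ∩ A y) ≤ μ.real {ω | Conn (G.edgeSet ∩ ω) x y} := by
      intro x y
      refine ENNReal.toReal_mono (measure_ne_top _ _) (measure_mono_ae ?_)
      filter_upwards [hu] with ω hω h
      exact HasUniqueInfiniteCluster.conn G hω h.1 h.2
    calc (θ * W.card) ^ 2 ≤ c ^ 2 := pow_le_pow_left₀ (by positivity) hcθ 2
      _ ≤ ∑ x ∈ W, ∑ y ∈ W, μ.real (A x ∩ A y) := hvar.trans_eq hX2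
      _ ≤ ∑ x ∈ W, ∑ y ∈ W, μ.real {ω | Conn (G.edgeSet ∩ ω) x y} :=
          Finset.sum_le_sum fun x _ => Finset.sum_le_sum fun y _ => hconn x y
      _ ≤ M * W.card := sum_conn_le G fun F hF => H F hF W
  -- θ² |W| ≤ M fails as soon as |W| exceeds M / θ².
  obtain ⟨n, hn⟩ := exists_nat_gt (M / θ ^ 2)
  obtain ⟨W, hWc⟩ := Infinite.exists_subset_card_eq V (n + 1)
  have h1 := hW W
  rw [hWc] at h1
  push_cast at h1
  rw [div_lt_iff₀ (by positivity)] at hn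
  have h2 : (0 : ℝ) < n + 1 := by positivity
  have h3 : θ ^ 2 * (n + 1 : ℝ) ≤ M := by
    by_contra! hlt
    have := mul_lt_mul_of_pos_right hlt h2
    nlinarith
  nlinarith [sq_nonneg θ]

end LocallyFinite

end InfiniteVolume

/-! ### Distances and spheres in a regular tree -/

section Tree

open scoped Classical

variable {V : Type*} {T : SimpleGraph V}

lemma exists_dist_eq_of_dist_eq_add (hc : T.Connected) {x z : V} {a b : ℕ}
    (h : T.dist x z = a + b) : ∃ w, T.dist x w = a ∧ T.dist w z = b := by
  obtain ⟨p, hp⟩ := hc.exists_walk_length_eq_dist x z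
  refine ⟨p.getVert a, ?_⟩
  have h1 : T.dist x (p.getVert a) ≤ a := by
    refine (SimpleGraph.dist_le (p.take a)).trans ?_
    simp
  have h2 : T.dist (p.getVert a) z ≤ b := by
    refine (SimpleGraph.dist_le (p.drop a)).trans ?_
    simp
    omega
  have h3 := hc.dist_triangle (u := x) (v := p.getVert a) (w := z)
  omega

/-- In a tree, exactly one neighbour of `x` is closer to `y`. -/
lemma existsUnique_closer (hT : T.IsTree) {x y : V} (hxy : x ≠ y) :
    ∃! z, T.Adj x z ∧ T.dist z y + 1 = T.dist x y := by
  have hpos := hT.connected.pos_dist_of_ne hxy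
  obtain ⟨w, hw1, hw2⟩ := exists_dist_eq_of_dist_eq_add hT.connected
    (show T.dist x y = 1 + (T.dist x y - 1) by omega)
  have hex : T.Adj x w ∧ T.dist w y + 1 = T.dist x y :=
    ⟨SimpleGraph.dist_eq_one_iff_adj.1 hw1, by omega⟩
  refine ⟨w, hex, ?_⟩
  -- A closer neighbour is the second vertex of a geodesic from x to y, and a tree has only one path
  -- from x to y.
  have hpath : ∀ z, T.Adj x z → T.dist z y + 1 = T.dist x y →
      ∃ p : T.Walk x y, p.IsPath ∧ p.getVert 1 = z := by
    intro z hz hd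
    obtain ⟨p, hp⟩ := hT.connected.exists_walk_length_eq_dist z y
    refine ⟨.cons hz p, SimpleGraph.Walk.isPath_of_length_eq_dist _ ?_, by simp⟩
    rw [SimpleGraph.Walk.length_cons, hp, hd]
  rintro z ⟨hz, hd⟩
  obtain ⟨p, hp, rfl⟩ := hpath z hz hd
  obtain ⟨p', hp', h'⟩ := hpath w hex.1 hex.2
  rw [← h', (hT.existsUnique_path x y).unique hp hp']

lemma dist_neighbor (hT : T.IsTree) {x z : V} (y : V) (hz : T.Adj x z) :
    T.dist z y + 1 = T.dist x y ∨ T.dist z y = T.dist x y + 1 := by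
  have := hT.dist_eq_dist_add_one_of_adj y hz
  rw [SimpleGraph.dist_comm (u := y) (v := x), SimpleGraph.dist_comm (u := y) (v := z)] at this
  omega

variable [T.LocallyFinite]

/-- The sphere of radius `d` around `x`. -/
noncomputable def sph (T : SimpleGraph V) [T.LocallyFinite] (x : V) : ℕ → Finset V
  | 0 => {x}
  | d + 1 => ((sph T x d).biUnion fun z => T.neighborFinset z).filter fun y => T.dist x y = d + 1

lemma mem_sph (hc : T.Connected) {x y : V} {d : ℕ} : y ∈ sph T x d ↔ T.dist x y = d := by
  induction d generalizing y with
  | zero => simp [sph, hc.dist_eq_zero_iff, eq_comm]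
  | succ d ih =>
    simp only [sph, Finset.mem_filter, Finset.mem_biUnion, SimpleGraph.mem_neighborFinset,
      and_iff_right_iff_imp]
    intro h
    obtain ⟨w, hw1, hw2⟩ := exists_dist_eq_of_dist_eq_add hc h
    exact ⟨w, ih.2 hw1, SimpleGraph.dist_eq_one_iff_adj.1 hw2⟩

lemma sph_one (hc : T.Connected) (x : V) : sph T x 1 = T.neighborFinset x := by
  ext y
  rw [mem_sph hc, SimpleGraph.dist_eq_one_iff_adj, SimpleGraph.mem_neighborFinset]

lemma card_closer (hT : T.IsTree) {x y : V} (hxy : x ≠ y) :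
    ((T.neighborFinset x).filter fun z => T.dist z y + 1 = T.dist x y).card = 1 := by
  obtain ⟨w, hw, huniq⟩ := existsUnique_closer hT hxy
  refine Finset.card_eq_one.2 ⟨w, ?_⟩
  ext z
  simp only [Finset.mem_filter, SimpleGraph.mem_neighborFinset, Finset.mem_singleton]
  exact ⟨huniq z, fun h => h ▸ hw⟩

lemma card_farther (hT : T.IsTree) {k : ℕ} (hreg : T.IsRegularOfDegree k) (x y : V) :
    ((T.neighborFinset x).filter fun z => T.dist z y = T.dist x y + 1).card =
      if x = y then k else k - 1 := by
  have hk : (T.neighborFinset x).card = k := hreg x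
  split_ifs with h
  · subst h
    rw [Finset.filter_true_of_mem, hk]
    intro z hz
    rw [SimpleGraph.mem_neighborFinset] at hz
    rw [SimpleGraph.dist_self, SimpleGraph.dist_eq_one_iff_adj.2 hz.symm]
  · have h1 := card_closer hT h
    have h2 := Finset.card_filter_add_card_filter_not (s := T.neighborFinset x)
      (fun z => T.dist z y + 1 = T.dist x y)
    have h3 : (T.neighborFinset x).filter (fun z => T.dist z y = T.dist x y + 1) =
        (T.neighborFinset x).filter (fun z => ¬ T.dist z y + 1 = T.dist x y) := by
      refine Finset.filter_congr fun z hz => ?_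
      have := dist_neighbor hT y ((SimpleGraph.mem_neighborFinset _ _ _).1 hz)
      omega
    rw [h3]
    omega

/-- The recursion for sums over spheres in a regular tree. -/
lemma sum_sum_sph (hT : T.IsTree) {k : ℕ} (hreg : T.IsRegularOfDegree k) (x : V) (e : ℕ)
    (g : V → ℝ) : ∑ z ∈ T.neighborFinset x, ∑ y ∈ sph T z (e + 1), g y =
      ∑ y ∈ sph T x (e + 2), g y + (if e = 0 then k else k - 1 : ℕ) * ∑ y ∈ sph T x e, g y := by
  have hc := hT.connected
  have hdisj : Disjoint (sph T x (e + 2)) (sph T x e) := by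
    rw [Finset.disjoint_left]
    intro y h1 h2
    rw [mem_sph hc] at h1 h2
    omega
  -- Double counting: a vertex y at distance e + 1 from a neighbour z of x is at distance e + 2 or e
  -- from x. It arises from the single closer neighbour in the first case, and from each of the k or
  -- k - 1 farther ones in the second.
  rw [Finset.sum_comm' (t' := sph T x (e + 2) ∪ sph T x e)
    (s' := fun y => (T.neighborFinset x).filter fun z => T.dist z y = e + 1), Finset.sum_union hdisj]
  · congr 1
    · refine Finset.sum_congr rfl fun y hy => ?_
      rw [mem_sph hc] at hy
      have hxy : x ≠ y := fun h => by subst h; simp at hy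
      have := card_closer hT hxy
      rw [hy] at this
      simp only [show ∀ z, (T.dist z y + 1 = e + 2) = (T.dist z y = e + 1) from
        fun z => by simp] at this
      rw [Finset.sum_const, this, one_smul]
    · rw [Finset.mul_sum]
      refine Finset.sum_congr rfl fun y hy => ?_
      rw [mem_sph hc] at hy
      have := card_farther hT hreg x y
      rw [hy] at this
      rw [Finset.sum_const, this, nsmul_eq_mul]
      have hiff : (x = y) = (e = 0) := propext (by rw [← hy, hc.dist_eq_zero_iff])
      simp only [hiff]
  · intro z y
    simp only [mem_sph hc, Finset.mem_filter, Finset.mem_union, SimpleGraph.mem_neighborFinset]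
    constructor
    · rintro ⟨hz, hd⟩
      exact ⟨⟨hz, hd⟩, by have := dist_neighbor hT y hz; omega⟩
    · rintro ⟨⟨hz, hd⟩, _⟩
      exact ⟨hz, hd⟩

/-! ### Sphere eigenvalues and the spherical function -/

/-- The eigenvalue of the sphere operators in the `k`-regular tree, in terms of the eigenvalue
`l` of the adjacency operator. -/
noncomputable def sphEigenvalue (k : ℕ) (l : ℝ) : ℕ → ℝ
  | 0 => 1
  | 1 => l
  | e + 2 => l * sphEigenvalue k l (e + 1) - (if e = 0 then k else k - 1 : ℕ) * sphEigenvalue k l e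

/-- Sphere operators are polynomials in the adjacency operator, so they share its eigenfunctions.
The constant function, with l = k, counts spheres; l = 2√(k - 1) yields the kernel bound. -/
lemma sum_sph_eq (hT : T.IsTree) {k : ℕ} (hreg : T.IsRegularOfDegree k) {g : V → ℝ} {l : ℝ}
    (hg : ∀ x, ∑ z ∈ T.neighborFinset x, g z = l * g x) (d : ℕ) :
    ∀ x, ∑ y ∈ sph T x d, g y = sphEigenvalue k l d * g x := by
  induction d using Nat.strong_induction_on with
  | _ d ih =>
    intro x
    match d with
    | 0 => simp [sph, sphEigenvalue]
    | 1 => rw [sph_one hT.connected, hg, sphEigenvalue]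
    | e + 2 =>
      have h1 := sum_sum_sph hT hreg x e g
      rw [ih e (by omega), Finset.sum_congr rfl fun z _ => ih (e + 1) (by omega) z,
        ← Finset.mul_sum, hg] at h1
      rw [sphEigenvalue]
      linarith

lemma sphEigenvalue_self {k : ℕ} (hk : 1 ≤ k) (e : ℕ) :
    sphEigenvalue k k (e + 1) = k * ((k : ℝ) - 1) ^ e := by
  induction e using Nat.strong_induction_on with
  | _ e ih =>
    match e with
    | 0 => simp [sphEigenvalue]
    | 1 => simp [sphEigenvalue]; ring
    | e + 2 =>
      rw [sphEigenvalue, ih (e + 1) (by omega), ih e (by omega), if_neg (by omega),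
        Nat.cast_sub hk]
      push_cast
      ring

/-- At l = 2√(k - 1) the characteristic equation t² = l t - (k - 1) has the double root √(k - 1), so
the solution is a power of the root times an affine function of the radius. -/
lemma sphEigenvalue_two_sqrt {k : ℕ} (hk : 2 ≤ k) (e : ℕ) :
    sphEigenvalue k (2 * √((k : ℝ) - 1)) (e + 1) =
      √((k : ℝ) - 1) ^ (e + 1) * ((e + 2) - e / ((k : ℝ) - 1)) := by
  have hk' : (2 : ℝ) ≤ k := by exact_mod_cast hk
  have hq : (0 : ℝ) < (k : ℝ) - 1 := by linarith
  have hs : √((k : ℝ) - 1) ^ 2 = (k : ℝ) - 1 := Real.sq_sqrt hq.le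
  have hkq : ((k - 1 : ℕ) : ℝ) = √((k : ℝ) - 1) ^ 2 := by
    rw [hs, Nat.cast_sub (by omega)]; simp
  induction e using Nat.strong_induction_on with
  | _ e ih =>
    match e with
    | 0 => simp [sphEigenvalue]; ring
    | 1 =>
      simp only [sphEigenvalue, if_true]
      have : (k : ℝ) = √((k : ℝ) - 1) ^ 2 + 1 := by rw [hs]; ring
      have h2 : √((k : ℝ) - 1) ^ 2 * (((1 : ℕ) : ℝ) / ((k : ℝ) - 1)) = 1 := by
        rw [hs]; field_simp; simp
      rw [show 1 + 1 = 2 from rfl, mul_sub, h2]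
      push_cast
      linarith
    | e + 2 =>
      rw [sphEigenvalue, ih (e + 1) (by omega), ih e (by omega), if_neg (by omega), hkq]
      push_cast
      ring

lemma sphEigenvalue_two_sqrt_le {k : ℕ} (hk : 2 ≤ k) (d : ℕ) :
    sphEigenvalue k (2 * √((k : ℝ) - 1)) d ≤ (d + 1) * √((k : ℝ) - 1) ^ d := by
  match d with
  | 0 => simp [sphEigenvalue]
  | e + 1 =>
    have hk' : (2 : ℝ) ≤ k := by exact_mod_cast hk
    rw [sphEigenvalue_two_sqrt hk, mul_comm]
    push_cast
    refine mul_le_mul_of_nonneg_right ?_ (by positivity)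
    have : (0 : ℝ) ≤ e / ((k : ℝ) - 1) := div_nonneg (by positivity) (by linarith)
    linarith

lemma card_sph_ge (hT : T.IsTree) {k : ℕ} (hk : 1 ≤ k) (hreg : T.IsRegularOfDegree k) (x : V)
    (d : ℕ) : ((k : ℝ) - 1) ^ d ≤ (sph T x d).card := by
  have h1 := sum_sph_eq hT hreg (g := fun _ => 1) (l := k) (fun x => by
    rw [Finset.sum_const, T.card_neighborFinset_eq_degree, hreg x]; simp) d x
  rw [Finset.sum_const, nsmul_eq_mul, mul_one, mul_one] at h1
  rw [h1]
  have hk' : (1 : ℝ) ≤ k := by exact_mod_cast hk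
  match d with
  | 0 => simp [sphEigenvalue]
  | e + 1 =>
    rw [sphEigenvalue_self hk, pow_succ, mul_comm]
    exact mul_le_mul_of_nonneg_right (by linarith) (pow_nonneg (by linarith) _)

/-- The spherical function: a positive eigenfunction of the adjacency operator at the bottom
`2 √(k - 1)` of the positive spectrum. -/
lemma exists_eigenfunction (hT : T.IsTree) {k : ℕ} (hk : 2 ≤ k) (hreg : T.IsRegularOfDegree k) :
    ∃ f : V → ℝ, (∀ x, 0 < f x) ∧
      ∀ x, ∑ z ∈ T.neighborFinset x, f z = 2 * √((k : ℝ) - 1) * f x := by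
  obtain ⟨o⟩ := hT.connected.nonempty
  have hk' : (2 : ℝ) ≤ k := by exact_mod_cast hk
  set q : ℝ := (k : ℝ) - 1 with hq
  have hq0 : 0 < q := by linarith
  set r := √q with hr
  have hr0 : 0 < r := Real.sqrt_pos.2 hq0
  have hrq : r ^ 2 = q := Real.sq_sqrt hq0.le
  -- By the double root, radial eigenfunctions away from o are (a + b n) r^(-n). The equation at o,
  -- (q + 1) φ(1) = 2 r φ(0), forces b / a = c; positivity follows from c ≥ 0.
  set c : ℝ := (q - 1) / (q + 1) with hc
  have hc0 : 0 ≤ c := div_nonneg (by linarith) (by linarith)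
  let φ : ℕ → ℝ := fun n => (1 + n * c) / r ^ n
  refine ⟨fun y => φ (T.dist y o), fun x => div_pos (by positivity) (by positivity), fun x => ?_⟩
  by_cases hx : x = o
  · subst hx
    beta_reduce
    have : ∀ z ∈ T.neighborFinset x, φ (T.dist z x) = φ 1 := fun z hz => by
      rw [SimpleGraph.dist_eq_one_iff_adj.2 ((SimpleGraph.mem_neighborFinset _ _ _).1 hz).symm]
    rw [Finset.sum_congr rfl this, Finset.sum_const, T.card_neighborFinset_eq_degree, hreg x,
      nsmul_eq_mul, SimpleGraph.dist_self, show (k : ℝ) = q + 1 by rw [hq]; ring]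
    simp only [φ, hc]
    have : q + 1 ≠ 0 := by positivity
    field_simp
    simp
    rw [hrq]
    ring
  · beta_reduce
    obtain ⟨n, hn⟩ : ∃ n, T.dist x o = n + 1 :=
      ⟨T.dist x o - 1, by have := hT.connected.pos_dist_of_ne hx; omega⟩
    have h1 := card_closer hT hx
    have h2 := card_farther hT hreg x o
    rw [if_neg hx] at h2
    have hsplit : ∀ z ∈ T.neighborFinset x, φ (T.dist z o) =
        (if T.dist z o + 1 = T.dist x o then φ n else 0) +
        (if T.dist z o = T.dist x o + 1 then φ (n + 2) else 0) := fun z hz => by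
      rcases dist_neighbor hT o ((SimpleGraph.mem_neighborFinset _ _ _).1 hz) with h | h
      · rw [if_pos h, if_neg (by omega), add_zero]
        congr 1; omega
      · rw [if_neg (by omega), if_pos h, zero_add]
        congr 1; omega
    rw [Finset.sum_congr rfl hsplit, Finset.sum_add_distrib, ← Finset.sum_filter,
      ← Finset.sum_filter, Finset.sum_const, Finset.sum_const, h1, h2, hn, one_smul, nsmul_eq_mul,
      Nat.cast_sub (by omega), Nat.cast_one, ← hq, ← hrq]
    simp only [φ]
    field_simp
    push_cast
    ring

lemma sum_mul_pow_le {r : ℝ} (hr0 : 0 ≤ r) (hr1 : r < 1) (D : ℕ) :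
    ∑ d ∈ Finset.range D, (d + 1 : ℝ) * r ^ d ≤ 1 / (1 - r) ^ 2 := by
  have h : ∀ D : ℕ, (∑ d ∈ Finset.range D, (d + 1 : ℝ) * r ^ d) * (1 - r) ^ 2 =
      1 - (D + 1) * r ^ D + D * r ^ (D + 1) := by
    intro D
    induction D with
    | zero => simp
    | succ D ih => rw [Finset.sum_range_succ, add_mul, ih]; push_cast; ring
  rw [le_div_iff₀ (by have : 0 < 1 - r := by linarith
                      positivity), h]
  have h1 : r ^ (D + 1) ≤ r ^ D := pow_le_pow_of_le_one hr0 hr1.le (Nat.le_succ D)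
  have h2 : 0 ≤ r ^ D := pow_nonneg hr0 D
  have h3 : (D : ℝ) * r ^ (D + 1) ≤ D * r ^ D := mul_le_mul_of_nonneg_left h1 (Nat.cast_nonneg D)
  linarith

/-- The kernel `(k - 1) ^ (-d(x, y))` is bounded on an eigenfunction as above. -/
lemma sum_inv_pow_dist_le (hT : T.IsTree) {k : ℕ} (hk : 3 ≤ k) (hreg : T.IsRegularOfDegree k)
    {f : V → ℝ} (hf0 : ∀ x, 0 < f x)
    (hf : ∀ x, ∑ z ∈ T.neighborFinset x, f z = 2 * √((k : ℝ) - 1) * f x) (x : V) (Z : Finset V) :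
    ∑ y ∈ Z, (((k : ℝ) - 1) ^ T.dist x y)⁻¹ * f y ≤
      ((k : ℝ) - 1) / (√((k : ℝ) - 1) - 1) ^ 2 * f x := by
  have hk' : (3 : ℝ) ≤ k := by exact_mod_cast hk
  set q : ℝ := (k : ℝ) - 1 with hq
  have hq0 : 1 < q := by linarith
  set s := √q with hs
  have hs1 : 1 < s := by rw [hs]; exact Real.lt_sqrt_of_sq_lt (by linarith)
  have hsq : s ^ 2 = q := Real.sq_sqrt (by linarith)
  obtain ⟨D, hD⟩ : ∃ D, ∀ y ∈ Z, T.dist x y < D :=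
    ⟨Z.sup (T.dist x) + 1, fun y hy => Nat.lt_succ_of_le (Finset.le_sup hy)⟩
  -- With q = s², the weight q^(-d) against a sphere eigenvalue of at most (d + 1) s^d leaves the
  -- summable (d + 1) s^(-d).
  have hterm : ∀ d, ∑ y ∈ Z.filter (fun y => T.dist x y = d), (q ^ T.dist x y)⁻¹ * f y ≤
      (d + 1) * s⁻¹ ^ d * f x := by
    intro d
    calc ∑ y ∈ Z.filter (fun y => T.dist x y = d), (q ^ T.dist x y)⁻¹ * f y
        = (q ^ d)⁻¹ * ∑ y ∈ Z.filter (fun y => T.dist x y = d), f y := by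
          rw [Finset.mul_sum]
          exact Finset.sum_congr rfl fun y hy => by rw [(Finset.mem_filter.1 hy).2]
      _ ≤ (q ^ d)⁻¹ * ∑ y ∈ sph T x d, f y := by
          refine mul_le_mul_of_nonneg_left (Finset.sum_le_sum_of_subset_of_nonneg (fun y hy => ?_)
            fun y _ _ => (hf0 y).le) (by positivity)
          exact (mem_sph hT.connected).2 (Finset.mem_filter.1 hy).2
      _ ≤ (q ^ d)⁻¹ * ((d + 1) * s ^ d * f x) := by
          rw [sum_sph_eq hT hreg hf]
          refine mul_le_mul_of_nonneg_left (mul_le_mul_of_nonneg_right ?_ (hf0 x).le)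
            (by positivity)
          exact sphEigenvalue_two_sqrt_le (by omega) d
      _ = _ := by
          rw [← hsq]
          have : s ≠ 0 := by positivity
          rw [inv_pow]
          field_simp
          ring
  calc ∑ y ∈ Z, (q ^ T.dist x y)⁻¹ * f y
      = ∑ d ∈ Finset.range D, ∑ y ∈ Z.filter (fun y => T.dist x y = d),
          (q ^ T.dist x y)⁻¹ * f y :=
        (Finset.sum_fiberwise_of_maps_to (fun y hy => Finset.mem_range.2 (hD y hy)) _).symm
    _ ≤ ∑ d ∈ Finset.range D, (d + 1) * s⁻¹ ^ d * f x := Finset.sum_le_sum fun d _ => hterm d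
    _ ≤ 1 / (1 - s⁻¹) ^ 2 * f x := by
        rw [← Finset.sum_mul]
        exact mul_le_mul_of_nonneg_right
          (sum_mul_pow_le (by positivity) (inv_lt_one_of_one_lt₀ hs1) D) (hf0 x).le
    _ = _ := by
        congr 1
        rw [← hsq]
        have h1 : s - 1 ≠ 0 := by linarith
        have h2 : s ≠ 0 := by positivity
        field_simp

lemma countable_of_isTree (hT : T.IsTree) : Countable V := by
  obtain ⟨o⟩ := hT.connected.nonempty
  rw [← Set.countable_univ_iff]
  have : (Set.univ : Set V) = ⋃ d, (sph T o d : Set V) := by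
    ext y
    simp only [Set.mem_univ, Set.mem_iUnion, Finset.mem_coe, true_iff]
    exact ⟨_, (mem_sph hT.connected).2 rfl⟩
  rw [this]
  exact Set.countable_iUnion fun d => (sph T o d).countable_toSet

lemma infinite_of_isTree (hT : T.IsTree) {k : ℕ} (hk : 3 ≤ k) (hreg : T.IsRegularOfDegree k) :
    Infinite V := by
  obtain ⟨o⟩ := hT.connected.nonempty
  by_contra hfin
  rw [not_infinite_iff_finite] at hfin
  have := Fintype.ofFinite V
  have hk' : (3 : ℝ) ≤ k := by exact_mod_cast hk
  obtain ⟨n, hn⟩ := pow_unbounded_of_one_lt (Fintype.card V : ℝ)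
    (show (1 : ℝ) < (k : ℝ) - 1 by linarith)
  have h1 := card_sph_ge hT (by omega) hreg o n
  have h2 : ((sph T o n).card : ℝ) ≤ Fintype.card V := by exact_mod_cast Finset.card_le_univ _
  linarith

/-! ### Labelling by words and two-point homogeneity -/

/-- An enumeration of a finite set with a prescribed first element. -/
lemma exists_enumeration {V : Type*} [Nonempty V] (S : Finset V) (a : Option V)
    (ha : ∀ b ∈ a, b ∈ S) :
    ∃ e : ℕ → V, (∀ i < S.card, e i ∈ S) ∧ (∀ i < S.card, ∀ j < S.card, e i = e j → i = j) ∧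
      (∀ v ∈ S, ∃ i < S.card, e i = v) ∧ ∀ b ∈ a, e 0 = b := by
  obtain ⟨l, hl, hlS, hla⟩ : ∃ l : List V, l.Nodup ∧ l.toFinset = S ∧ ∀ b ∈ a, l.head? = some b := by
    cases a with
    | none => exact ⟨S.toList, S.nodup_toList, by simp, by simp⟩
    | some b =>
      refine ⟨b :: (S.erase b).toList, ?_, ?_, ?_⟩
      · simp [Finset.nodup_toList]
      · have := ha b rfl
        simp [this]
      · simp
  have hcard : S.card = l.length := by rw [← hlS, List.toFinset_card_of_nodup hl]
  have hget : ∀ i, (h : i < l.length) → l.getD i (Classical.arbitrary V) = l[i] := fun i h => by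
    simp [h]
  refine ⟨fun i => l.getD i (Classical.arbitrary V), ?_, ?_, ?_, ?_⟩
  · intro i hi
    rw [hcard] at hi
    beta_reduce
    rw [hget i hi, ← hlS]
    simp
  · intro i hi j hj h
    rw [hcard] at hi hj
    simp only [hget i hi, hget j hj] at h
    exact (List.Nodup.getElem_inj_iff hl).1 h
  · intro v hv
    rw [← hlS, List.mem_toFinset] at hv
    obtain ⟨i, hi, h⟩ := List.getElem_of_mem hv
    exact ⟨i, hcard ▸ hi, by beta_reduce; rw [hget i hi, h]⟩
  · intro b hb
    have := hla b hb
    cases l with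
    | nil => simp at this
    | cons c l => simpa using this

/-- The words that label the vertices of a rooted `k`-regular tree: a word is the sequence of
choices of children, the last choice first. -/
def IsWord (k : ℕ) : List ℕ → Prop
  | [] => True
  | a :: l => (a < if l = [] then k else k - 1) ∧ IsWord k l

/-- A regular tree is labelled by words, in such a way that a given vertex is the root, and
another one is labelled by a constant word. -/
lemma exists_labelling (hT : T.IsTree) {k : ℕ} (hreg : T.IsRegularOfDegree k)
    (x y : V) : ∃ ψ : {l : List ℕ // IsWord k l} ≃ V,
      (∀ l m, T.Adj (ψ l) (ψ m) ↔ (∃ a, l.1 = a :: m.1) ∨ ∃ a, m.1 = a :: l.1) ∧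
      (∀ l, l.1 = [] → ψ l = x) ∧ ∀ l, l.1 = List.replicate (T.dist x y) 0 → ψ l = y := by
  have hc := hT.connected
  have : Nonempty V := ⟨x⟩
  let children : V → Finset V := fun v =>
    (T.neighborFinset v).filter fun z => T.dist z x = T.dist v x + 1
  have hchildren : ∀ v z, z ∈ children v ↔ T.Adj v z ∧ T.dist z x = T.dist v x + 1 := fun v z => by
    simp [children]
  have hcard : ∀ v, (children v).card = if v = x then k else k - 1 := fun v =>
    card_farther hT hreg v x
  -- At a vertex of the geodesic from x to y, the child numbered 0 is prescribed to be the next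
  -- vertex towards y, so that y receives a word of zeros.
  have hnext : ∀ v, ∃ a : Option V, (∀ b ∈ a, b ∈ children v) ∧
      (T.dist x v + T.dist v y = T.dist x y → v ≠ y → ∃ b ∈ a, T.dist b y + 1 = T.dist v y) := by
    intro v
    by_cases h : T.dist x v + T.dist v y = T.dist x y ∧ v ≠ y
    · obtain ⟨b, ⟨hb, hd⟩, _⟩ := existsUnique_closer hT h.2
      refine ⟨some b, ?_, fun _ _ => ⟨b, rfl, hd⟩⟩
      rintro _ ⟨⟩
      rw [hchildren]
      refine ⟨hb, (dist_neighbor hT x hb).resolve_left fun h' => ?_⟩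
      have h1 := hc.dist_triangle (u := x) (v := b) (w := y)
      have h2 := h.1
      rw [SimpleGraph.dist_comm (u := x) (v := v)] at h2
      rw [SimpleGraph.dist_comm (u := x) (v := b)] at h1
      omega
    · exact ⟨none, by simp, fun h1 h2 => absurd ⟨h1, h2⟩ h⟩
  choose a ha1 ha2 using hnext
  choose e he1 he2 he3 he4 using fun v => exists_enumeration (children v) (a v) (ha1 v)
  let ψ : List ℕ → V := fun l => l.foldr (fun i v => e v i) x
  have hψ0 : ψ [] = x := rfl
  have hψ1 : ∀ i l, ψ (i :: l) = e (ψ l) i := fun _ _ => rfl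
  have hdist : ∀ l, IsWord k l → T.dist (ψ l) x = l.length ∧
      (children (ψ l)).card = if l = [] then k else k - 1 := by
    intro l
    induction l with
    | nil => intro _; simp [hψ0, hcard]
    | cons i l ih =>
      rintro ⟨hi, hl⟩
      obtain ⟨h1, h2⟩ := ih hl
      have h3 := ((hchildren _ _).1 (he1 (ψ l) i (h2 ▸ hi))).2
      rw [← hψ1, h1] at h3
      refine ⟨by rw [h3, List.length_cons], ?_⟩
      rw [hcard, if_neg, if_neg (by simp)]
      intro h
      rw [h, SimpleGraph.dist_self] at h3
      omega
  have hchild : ∀ i l, IsWord k (i :: l) → T.Adj (ψ l) (ψ (i :: l)) ∧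
      T.dist (ψ l) x + 1 = T.dist (ψ (i :: l)) x := fun i l h => by
    have := (hchildren _ _).1 (he1 (ψ l) i ((hdist l h.2).2 ▸ h.1))
    exact ⟨this.1, this.2.symm⟩
  have hparent : ∀ {v u u'}, T.Adj u v → T.Adj u' v → T.dist u x + 1 = T.dist v x →
      T.dist u' x + 1 = T.dist v x → u = u' := by
    intro v u u' h h' hd hd'
    have hvx : v ≠ x := fun h => by rw [h, SimpleGraph.dist_self] at hd; omega
    exact (existsUnique_closer hT hvx).unique ⟨h.symm, hd⟩ ⟨h'.symm, hd'⟩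
  -- The parent of a vertex is its unique neighbour closer to x, so equal vertices have equal
  -- parents, and induction on words applies.
  have hinj : ∀ l m, IsWord k l → IsWord k m → ψ l = ψ m → l = m := by
    intro l
    induction l with
    | nil =>
      intro m _ hm h
      have := (hdist m hm).1
      rw [← h, hψ0, SimpleGraph.dist_self] at this
      exact (List.length_eq_zero_iff.1 this.symm).symm
    | cons i l ih =>
      intro m hl hm h
      cases m with
      | nil =>
        have := (hdist _ hl).1
        rw [h, hψ0, SimpleGraph.dist_self] at this
        simp at this
      | cons j m =>
        have h1 := hchild i l hl
        have h2 := hchild j m hm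
        rw [← h] at h2
        have h3 := ih m hl.2 hm.2 (hparent h1.1 h2.1 h1.2 h2.2)
        subst h3
        have h4 := (hdist l hl.2).2
        rw [he2 (ψ l) i (h4 ▸ hl.1) j (h4 ▸ hm.1) h]
  have hsurj : ∀ n v, T.dist v x = n → ∃ l, IsWord k l ∧ ψ l = v := by
    intro n
    induction n with
    | zero =>
      intro v hv
      exact ⟨[], trivial, (hc.dist_eq_zero_iff.1 hv).symm⟩
    | succ n ih =>
      intro v hv
      have hvx : v ≠ x := fun h => by rw [h, SimpleGraph.dist_self] at hv; omega
      obtain ⟨u, ⟨hu, hd⟩, _⟩ := existsUnique_closer hT hvx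
      obtain ⟨l, hl, rfl⟩ := ih u (by omega)
      obtain ⟨i, hi, h⟩ := he3 (ψ l) v ((hchildren _ _).2 ⟨hu.symm, hd.symm⟩)
      rw [(hdist l hl).2] at hi
      exact ⟨i :: l, ⟨hi, hl⟩, h⟩
  let Ψ : {l : List ℕ // IsWord k l} ≃ V := Equiv.ofBijective (fun l => ψ l.1)
    ⟨fun l m h => Subtype.ext (hinj l.1 m.1 l.2 m.2 h), fun v => by
      obtain ⟨l, hl, h⟩ := hsurj _ v rfl
      exact ⟨⟨l, hl⟩, h⟩⟩
  have hΨ : ∀ l, Ψ l = ψ l.1 := fun _ => rfl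
  have hadj : ∀ l m, IsWord k l → IsWord k m → T.Adj (ψ l) (ψ m) →
      T.dist (ψ m) x + 1 = T.dist (ψ l) x → ∃ i, l = i :: m := by
    intro l m hl hm h hd
    cases l with
    | nil => rw [hψ0, SimpleGraph.dist_self] at hd; omega
    | cons i l =>
      have h1 := hchild i l hl
      exact ⟨i, by rw [hinj l m hl.2 hm (hparent h1.1 h.symm h1.2 hd)]⟩
  refine ⟨Ψ, fun l m => ?_, fun l hl => by rw [hΨ, hl, hψ0], fun l hl => ?_⟩
  · rw [hΨ, hΨ]
    constructor
    · intro h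
      rcases dist_neighbor hT x h with h' | h'
      · exact Or.inl (hadj _ _ l.2 m.2 h h')
      · exact Or.inr (hadj _ _ m.2 l.2 h.symm h'.symm)
    · rintro (⟨i, hi⟩ | ⟨i, hi⟩)
      · have := (hchild i m.1 (hi ▸ l.2)).1.symm
        rwa [← hi] at this
      · have := (hchild i l.1 (hi ▸ m.2)).1
        rwa [← hi] at this
  · rw [hΨ, hl]
    have hgeo : ∀ j ≤ T.dist x y, T.dist x (ψ (List.replicate j 0)) = j ∧
        T.dist (ψ (List.replicate j 0)) y + j = T.dist x y := by
      intro j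
      induction j with
      | zero => intro _; simp [hψ0]
      | succ j ih =>
        intro hj
        obtain ⟨h1, h2⟩ := ih (by omega)
        set v := ψ (List.replicate j 0) with hv
        have hvy : v ≠ y := fun h => by rw [h, SimpleGraph.dist_self] at h2; omega
        obtain ⟨b, hb, hd⟩ := ha2 v (by omega) hvy
        have hb' : ψ (List.replicate (j + 1) 0) = b := by
          rw [List.replicate_succ, hψ1, ← hv]
          exact he4 v b hb
        have hbc := ((hchildren _ _).1 (ha1 v b hb)).2
        rw [hb', SimpleGraph.dist_comm, hbc, SimpleGraph.dist_comm, h1]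
        exact ⟨rfl, by omega⟩
    have := (hgeo _ le_rfl).2
    exact hc.dist_eq_zero_iff.1 (by omega)

lemma isWord_replicate {k : ℕ} (hk : 2 ≤ k) (d : ℕ) : IsWord k (List.replicate d 0) := by
  induction d with
  | zero => trivial
  | succ d ih =>
    refine ⟨?_, ih⟩
    split_ifs <;> omega

/-- A regular tree is two-point homogeneous. -/
lemma exists_iso_of_dist_eq (hT : T.IsTree) {k : ℕ} (hk : 2 ≤ k) (hreg : T.IsRegularOfDegree k)
    {x y x' y' : V} (h : T.dist x y = T.dist x' y') : ∃ φ : T ≃g T, φ x = x' ∧ φ y = y' := by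
  obtain ⟨ψ, h1, h2, h3⟩ := exists_labelling hT hreg x y
  obtain ⟨ψ', h1', h2', h3'⟩ := exists_labelling hT hreg x' y'
  -- Adjacency is read off the words, and the set of words depends only on k. Equal distances give y
  -- and y' the same word of zeros.
  refine ⟨⟨ψ.symm.trans ψ', fun {a b} => ?_⟩, ?_, ?_⟩
  · obtain ⟨l, rfl⟩ := ψ.surjective a
    obtain ⟨m, rfl⟩ := ψ.surjective b
    simp [h1, h1']
  · change ψ' (ψ.symm x) = x'
    rw [← h2 ⟨[], trivial⟩ rfl, Equiv.symm_apply_apply, h2' _ rfl]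
  · change ψ' (ψ.symm y) = y'
    rw [← h3 ⟨_, isWord_replicate hk _⟩ rfl, Equiv.symm_apply_apply]
    exact h3' _ (by rw [← h])

end Tree

/-! ### Supermultiplicativity, the Schur test and persistence under sprinkling -/

section Transitive

open scoped Classical

variable {V : Type*} {G : SimpleGraph V}

/-- If from `x` one can reach exponentially many vertices by `n` translates of the displacement
from `x` to `y`, then the finiteness of the expected cluster size bounds the connection
probability between `x` and `y`. -/
lemma mul_tau_le_one {q : ℝ} (hq0 : 0 ≤ q) (hq1 : q ≤ 1) {M : ℝ}
    (hM : ∀ (F : Finset (Sym2 V)), (F : Set (Sym2 V)) ⊆ G.edgeSet → ∀ (x : V) (Z : Finset V),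
      ∑ y ∈ Z, tau F (fun _ => q) x y ≤ M)
    {F : Finset (Sym2 V)} (hF : (F : Set (Sym2 V)) ⊆ G.edgeSet) {x y : V} (P : ℕ → V → Prop)
    (hP0 : ∀ z, P 0 z → z = x)
    (hPs : ∀ n z, P (n + 1) z → ∃ w, P n w ∧ ∃ φ : G ≃g G, φ x = w ∧ φ y = z)
    {b : ℝ}
    (hcard : ∀ n, ∃ Z : Finset V, (∀ z ∈ Z, P n z) ∧ b ^ n ≤ Z.card) :
    b * tau F (fun _ => q) x y ≤ 1 := by
  have hp : IsProb (fun _ : Sym2 V => q) := isProb_const hq0 hq1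
  set t := tau F (fun _ => q) x y with ht
  have ht0 : 0 ≤ t := tau_nonneg hp _ _
  -- Each step of the chain is a translate of the pair (x, y), so it costs a factor t in the
  -- translated edge set; the edge sets accumulate.
  have chain : ∀ n z, P n z → ∃ F' : Finset (Sym2 V), (F' : Set (Sym2 V)) ⊆ G.edgeSet ∧
      t ^ n ≤ tau F' (fun _ => q) x z := by
    intro n
    induction n with
    | zero =>
      intro z hz
      refine ⟨∅, by simp, ?_⟩
      rw [hP0 z hz, tau_self, pow_zero]
    | succ n ih =>
      intro z hz
      obtain ⟨w, hw, φ, rfl, rfl⟩ := hPs n z hz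
      obtain ⟨F₁, hF₁, h1⟩ := ih _ hw
      have h2 : t = tau (F.map φ.toEquiv.toEmbedding.sym2Map) (fun _ => q) (φ x) (φ y) :=
        (tau_map φ.toEquiv F q x y).symm
      refine ⟨F₁ ∪ F.map φ.toEquiv.toEmbedding.sym2Map, ?_, ?_⟩
      · rw [Finset.coe_union]
        exact Set.union_subset hF₁ (map_subset_edgeSet φ hF)
      · rw [pow_succ]
        refine le_trans ?_ (tau_mul_tau_le hp x (φ x) (φ y))
        refine mul_le_mul (h1.trans (tau_mono_set Finset.subset_union_left hp _ _)) ?_ ht0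
          (tau_nonneg hp _ _)
        rw [h2]
        exact tau_mono_set Finset.subset_union_right hp _ _
  -- The powers of b t are bounded by `M` uniformly in n, which forces b t ≤ 1; `M` itself
  -- disappears from the conclusion.
  have hpow : ∀ n : ℕ, (b * t) ^ n ≤ M := by
    intro n
    obtain ⟨Z, hZ, hc⟩ := hcard n
    choose F' hF' hle using chain n
    let F'' : Finset (Sym2 V) := Z.attach.biUnion fun z => F' z.1 (hZ z.1 z.2)
    have hF'' : (F'' : Set (Sym2 V)) ⊆ G.edgeSet := by
      intro e he
      obtain ⟨z, _, hez⟩ := Finset.mem_biUnion.1 (Finset.mem_coe.1 he)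
      exact hF' _ _ hez
    calc (b * t) ^ n = b ^ n * t ^ n := mul_pow _ _ _
      _ ≤ Z.card * t ^ n := mul_le_mul_of_nonneg_right hc (pow_nonneg ht0 n)
      _ = Z.card • t ^ n := (nsmul_eq_mul _ _).symm
      _ ≤ ∑ z ∈ Z, tau F'' (fun _ => q) x z := Finset.card_nsmul_le_sum _ _ _ fun z hz =>
          (hle z (hZ z hz)).trans (tau_mono_set (fun e he => Finset.mem_biUnion.2
            ⟨⟨z, hz⟩, Finset.mem_attach _ _, he⟩) hp _ _)
      _ ≤ M := hM F'' hF'' x Z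
  by_contra! h
  obtain ⟨n, hn⟩ := pow_unbounded_of_one_lt M h
  exact absurd (hpow n) (not_le.2 hn)

lemma le_tau_of_mem {F : Finset (Sym2 V)} {p : Sym2 V → ℝ} (hp : IsProb p) {x y : V}
    (h : s(x, y) ∈ F) : p s(x, y) ≤ tau F p x y :=
  (ev_mem h p).symm.le.trans (ev_mono hp fun _ _ => ind_mono fun h => Conn.of_mem h)

/-- The Schur test. -/
lemma sum_sum_tau_le {F : Finset (Sym2 V)} {p : Sym2 V → ℝ} (hp : IsProb p) {f : V → ℝ}
    (hf : ∀ x, 0 < f x) {M : ℝ} (W : Finset V)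
    (H : ∀ x ∈ W, ∑ y ∈ W, tau F p x y * f y ≤ M * f x) :
    ∑ x ∈ W, ∑ y ∈ W, tau F p x y ≤ M * W.card := by
  have h1 : ∑ x ∈ W, ∑ y ∈ W, tau F p x y * (f y / f x) ≤ M * W.card := by
    calc ∑ x ∈ W, ∑ y ∈ W, tau F p x y * (f y / f x) ≤ ∑ x ∈ W, M := by
          refine Finset.sum_le_sum fun x hx => ?_
          have := H x hx
          rw [← div_le_iff₀ (hf x), Finset.sum_div] at this
          simpa only [mul_div_assoc] using this
      _ = M * W.card := by rw [Finset.sum_const, nsmul_eq_mul, mul_comm]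
  have h2 : ∑ x ∈ W, ∑ y ∈ W, tau F p x y * (f x / f y) =
      ∑ x ∈ W, ∑ y ∈ W, tau F p x y * (f y / f x) := by
    rw [Finset.sum_comm]
    exact Finset.sum_congr rfl fun x _ => Finset.sum_congr rfl fun y _ => by rw [tau_comm]
  -- 2 ≤ f x / f y + f y / f x, and by symmetry of τ the two ratios contribute equally.
  have h3 : ∑ x ∈ W, ∑ y ∈ W, 2 * tau F p x y ≤ ∑ x ∈ W, ∑ y ∈ W,
      (tau F p x y * (f x / f y) + tau F p x y * (f y / f x)) := by
    refine Finset.sum_le_sum fun x _ => Finset.sum_le_sum fun y _ => ?_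
    rw [← mul_add, mul_comm]
    refine mul_le_mul_of_nonneg_left ?_ (tau_nonneg hp _ _)
    have hx := hf x
    have hy := hf y
    rw [div_add_div _ _ hy.ne' hx.ne', le_div_iff₀ (by positivity)]
    nlinarith [sq_nonneg (f x - f y)]
  simp only [Finset.sum_add_distrib, ← Finset.mul_sum] at h3
  linarith

/-- Boundedness of the two-point function on a positive function persists under a small increase
of the retention probability. -/
lemma sum_tau_le_of_lt {q p : ℝ} (hq0 : 0 ≤ q) (hqp : q ≤ p) (hp1 : p ≤ 1) {f : V → ℝ}
    (hf : ∀ x, 0 < f x) {α C : ℝ} (hα : 0 ≤ α)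
    (hadj : ∀ (u : V) (Z : Finset V), (∀ v ∈ Z, G.Adj u v) → ∑ v ∈ Z, f v ≤ α * f u)
    (hC : ∀ (F : Finset (Sym2 V)), (F : Set (Sym2 V)) ⊆ G.edgeSet → ∀ (x : V) (Z : Finset V),
      ∑ y ∈ Z, tau F (fun _ => q) x y * f y ≤ C * f x)
    (hlt : (p - q) * (α * C) < 1 - q) :
    ∃ M : ℝ, ∀ (F : Finset (Sym2 V)), (F : Set (Sym2 V)) ⊆ G.edgeSet → ∀ (x : V) (Z : Finset V),
      ∑ y ∈ Z, tau F (fun _ => p) x y * f y ≤ M * f x := by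
  have hpp : IsProb (fun _ : Sym2 V => p) := isProb_const (hq0.trans hqp) hp1
  have hpq : IsProb (fun _ : Sym2 V => q) := isProb_const hq0 (hqp.trans hp1)
  by_cases hq1 : q = 1
  · have : p = q := le_antisymm (hq1 ▸ hp1) hqp
    exact ⟨C, this ▸ hC⟩
  have hq : 0 < 1 - q := sub_pos.2 (lt_of_le_of_ne (hqp.trans hp1) hq1)
  -- The density that solves 1 - (1 - q)(1 - δ) = p.
  set δ := (p - q) / (1 - q) with hδ
  have hδ0 : 0 ≤ δ := div_nonneg (by linarith) hq.le
  have hδ1 : δ ≤ 1 := (div_le_one hq).2 (by linarith)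
  have hβ : δ * (α * C) < 1 := by
    rw [hδ, div_mul_eq_mul_div, div_lt_one hq]
    exact hlt
  refine ⟨C / (1 - δ * (α * C)), fun F hF x Z₀ => ?_⟩
  obtain ⟨Z, hZ₀, hZ⟩ := exists_vertexSet F (insert x Z₀)
  refine (Finset.sum_le_sum_of_subset_of_nonneg ((Finset.subset_insert _ _).trans hZ₀)
    fun y _ _ => mul_nonneg (tau_nonneg hpp _ _) (hf y).le).trans
    (sum_tau_le_of_sprinkle hZ hf hβ (fun x _ => ⟨fun _ => q, fun _ => δ, hpq,
      isProb_const hδ0 hδ1, fun _ => ?_, hC F hF x Z, ?_⟩) (hZ₀ (Finset.mem_insert_self _ _)))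
  · rw [hδ]
    field_simp
    ring
  · calc ∑ u ∈ Z, ∑ v ∈ Z, (if s(u, v) ∈ F then tau F (fun _ => q) x u * (δ * f v) else 0)
        ≤ ∑ u ∈ Z, tau F (fun _ => q) x u * (δ * (α * f u)) := by
          refine Finset.sum_le_sum fun u _ => ?_
          rw [← Finset.sum_filter, ← Finset.mul_sum, ← Finset.mul_sum]
          refine mul_le_mul_of_nonneg_left (mul_le_mul_of_nonneg_left (hadj u _ fun v hv => ?_) hδ0)
            (tau_nonneg hpq _ _)
          exact hF (Finset.mem_filter.1 hv).2
      _ = δ * α * ∑ u ∈ Z, tau F (fun _ => q) x u * f u := by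
          rw [Finset.mul_sum]
          exact Finset.sum_congr rfl fun _ _ => by ring
      _ ≤ δ * α * (C * f x) :=
          mul_le_mul_of_nonneg_left (hC F hF x Z) (mul_nonneg hδ0 hα)
      _ = δ * (α * C) * f x := by ring

end Transitive

/-! ### The product of trees -/

section Product

open scoped Classical

variable {ι : Type*} {V : ι → Type*} {T : ∀ i, SimpleGraph (V i)}

lemma cartesianProduct_adj_iff {x y : ∀ i, V i} : (cartesianProduct T).Adj x y ↔
    ∃ i, (T i).Adj (x i) (y i) ∧ y = Function.update x i (y i) := by
  refine exists_congr fun i => and_congr_right fun _ => ?_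
  constructor
  · intro h
    ext j
    by_cases hj : j = i
    · subst hj; simp
    · rw [Function.update_of_ne hj, h j hj]
  · intro h j hj
    rw [h, Function.update_of_ne hj]

/-- The product of automorphisms of the factors. -/
def cartesianProductIso (φ : ∀ i, T i ≃g T i) : cartesianProduct T ≃g cartesianProduct T where
  toEquiv := Equiv.piCongrRight fun i => (φ i).toEquiv
  map_rel_iff' := by
    intro x y
    simp [cartesianProduct, SimpleGraph.Iso.map_adj_iff]

variable {k : ι → ℕ}

lemma one_lt_degree_sub_one (hk : ∀ i, 3 ≤ k i) (i : ι) : 1 < (k i : ℝ) - 1 := by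
  have : (3 : ℝ) ≤ k i := by exact_mod_cast hk i
  linarith

variable [∀ i, (T i).LocallyFinite]

lemma exists_iso_of_forall_dist_eq (hk : ∀ i, 3 ≤ k i) (hT : ∀ i, (T i).IsTree)
    (hreg : ∀ i, (T i).IsRegularOfDegree (k i)) {x y x' y' : ∀ i, V i}
    (h : ∀ i, (T i).dist (x i) (y i) = (T i).dist (x' i) (y' i)) :
    ∃ φ : cartesianProduct T ≃g cartesianProduct T, φ x = x' ∧ φ y = y' := by
  choose φ h1 h2 using fun i =>
    exists_iso_of_dist_eq (hT i) (by have := hk i; omega : 2 ≤ k i) (hreg i) (h i)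
  exact ⟨cartesianProductIso φ, funext h1, funext h2⟩

lemma exists_iso_apply_eq (hk : ∀ i, 3 ≤ k i) (hT : ∀ i, (T i).IsTree)
    (hreg : ∀ i, (T i).IsRegularOfDegree (k i)) (x x' : ∀ i, V i) :
    ∃ φ : cartesianProduct T ≃g cartesianProduct T, φ x = x' := by
  obtain ⟨φ, h, _⟩ := exists_iso_of_forall_dist_eq hk hT hreg (x := x) (y := x) (x' := x')
    (y' := x') (fun i => by simp)
  exact ⟨φ, h⟩

variable [Fintype ι]

/-- The neighbours of `u` in the product, listed by the coordinate that changes. -/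
noncomputable def coordNeighbors (T : ∀ i, SimpleGraph (V i))
    [∀ i, (T i).LocallyFinite]
    (u : ∀ i, V i) : Finset ((i : ι) × V i) :=
  Finset.univ.sigma fun i => (T i).neighborFinset (u i)

lemma exists_coordNeighbor {u v : ∀ i, V i} (h : (cartesianProduct T).Adj u v) :
    ∃ a ∈ coordNeighbors T u, Function.update u a.1 a.2 = v := by
  obtain ⟨i, hi, hv⟩ := cartesianProduct_adj_iff.1 h
  exact ⟨⟨i, v i⟩, by simpa [coordNeighbors] using hi, hv.symm⟩

noncomputable instance : (cartesianProduct T).LocallyFinite := fun u =>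
  ((((coordNeighbors T u).image fun a => Function.update u a.1 a.2).finite_toSet).subset
    fun v (hv : (cartesianProduct T).Adj u v) => by
      obtain ⟨a, ha, h⟩ := exists_coordNeighbor hv
      exact Finset.mem_coe.2 (Finset.mem_image.2 ⟨a, ha, h⟩)).fintype

/-- In the subcritical regime, the two-point function is at most the inverse of the growth. -/
lemma tau_le_of_subcritical (hk : ∀ i, 3 ≤ k i) (hT : ∀ i, (T i).IsTree)
    (hreg : ∀ i, (T i).IsRegularOfDegree (k i)) {o : ∀ i, V i} {q : ℝ} (hq0 : 0 ≤ q) (hq1 : q ≤ 1)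
    (h : Subcritical (cartesianProduct T) o q) {F : Finset (Sym2 (∀ i, V i))}
    (hF : (F : Set (Sym2 (∀ i, V i))) ⊆ (cartesianProduct T).edgeSet) (x y : ∀ i, V i) :
    tau F (fun _ => q) x y ≤ ∏ i, (((k i : ℝ) - 1) ^ (T i).dist (x i) (y i))⁻¹ := by
  obtain ⟨M, hM⟩ := exists_sum_tau_le _ (exists_iso_apply_eq hk hT hreg) hq0 hq1 h
  have hpos : 0 < ∏ i, ((k i : ℝ) - 1) ^ (T i).dist (x i) (y i) :=
    Finset.prod_pos fun i _ => pow_pos (by linarith [one_lt_degree_sub_one hk i]) _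
  have main := mul_tau_le_one hq0 hq1 hM hF (x := x) (y := y)
    (b := ∏ i, ((k i : ℝ) - 1) ^ (T i).dist (x i) (y i))
    -- The vertices whose displacement from x has all coordinate distances multiplied by n. Their
    -- number is a product of sphere sizes, at least the n-th power of `b`, and geodesics in each
    -- coordinate provide the intermediate vertices.
    (fun n z => ∀ i, (T i).dist (x i) (z i) = n * (T i).dist (x i) (y i)) (fun z hz => ?_)
    (fun n z hz => ?_) fun n => ?_
  · rw [Finset.prod_inv_distrib, ← one_div, le_div_iff₀ hpos, mul_comm]
    exact main
  · ext i
    have := hz i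
    rw [zero_mul, (hT i).connected.dist_eq_zero_iff] at this
    exact this.symm
  · have : ∀ i, ∃ w, (T i).dist (x i) w = n * (T i).dist (x i) (y i) ∧
        (T i).dist w (z i) = (T i).dist (x i) (y i) := fun i =>
      exists_dist_eq_of_dist_eq_add (hT i).connected (by rw [hz i]; ring)
    choose w hw1 hw2 using this
    exact ⟨w, hw1, exists_iso_of_forall_dist_eq hk hT hreg fun i => (hw2 i).symm⟩
  · refine ⟨Fintype.piFinset fun i => sph (T i) (x i) (n * (T i).dist (x i) (y i)),
      fun z hz i => (mem_sph (hT i).connected).1 (Fintype.mem_piFinset.1 hz i), ?_⟩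
    rw [Fintype.card_piFinset, Nat.cast_prod, ← Finset.prod_pow]
    refine Finset.prod_le_prod (fun i _ => ?_) fun i _ => ?_
    · have := one_lt_degree_sub_one hk i
      positivity
    · rw [← pow_mul, mul_comm]
      exact card_sph_ge (hT i) (by have := hk i; omega) (hreg i) _ _

/-- In the subcritical regime, the retention probability is at most `1 / 2`. -/
lemma le_half_of_subcritical [Nonempty ι] (hk : ∀ i, 3 ≤ k i) (hT : ∀ i, (T i).IsTree)
    (hreg : ∀ i, (T i).IsRegularOfDegree (k i)) {o : ∀ i, V i} {q : ℝ} (hq0 : 0 ≤ q) (hq1 : q ≤ 1)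
    (h : Subcritical (cartesianProduct T) o q) : q ≤ 1 / 2 := by
  obtain ⟨i⟩ := ‹Nonempty ι›
  obtain ⟨w, hw⟩ : ((T i).neighborFinset (o i)).Nonempty := by
    rw [← Finset.card_pos, (T i).card_neighborFinset_eq_degree, hreg i]
    have := hk i; omega
  rw [SimpleGraph.mem_neighborFinset] at hw
  set y := Function.update o i w with hy
  have hadj : (cartesianProduct T).Adj o y :=
    cartesianProduct_adj_iff.2 ⟨i, by simpa [hy] using hw, by simp [hy]⟩
  -- For the single edge from o to y the two-point bound reads q ≤ 1 / (k_i - 1) ≤ 1/2.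
  have h1 := tau_le_of_subcritical hk hT hreg hq0 hq1 h (F := {s(o, y)})
    (by simpa using hadj) o y
  have h2 := le_tau_of_mem (isProb_const (E := Sym2 (∀ i, V i)) hq0 hq1)
    (Finset.mem_singleton_self s(o, y))
  refine h2.trans (h1.trans ?_)
  have hdist : (T i).dist (o i) (y i) = 1 := by
    rw [SimpleGraph.dist_eq_one_iff_adj]; simpa [hy] using hw
  rw [← Finset.mul_prod_erase _ _ (Finset.mem_univ i), hdist, pow_one]
  have hki : (3 : ℝ) ≤ k i := by exact_mod_cast hk i
  have h4 : ((k i : ℝ) - 1)⁻¹ ≤ 1 / 2 := by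
    rw [one_div]
    exact inv_anti₀ (by norm_num) (by linarith)
  have h5 : ∏ j ∈ Finset.univ.erase i, (((k j : ℝ) - 1) ^ (T j).dist (o j) (y j))⁻¹ ≤ 1 :=
    Finset.prod_le_one (fun j _ => by have := one_lt_degree_sub_one hk j; positivity) fun j _ =>
      inv_le_one_of_one_le₀ (one_le_pow₀ (one_lt_degree_sub_one hk j).le)
  have h6 : 0 ≤ ((k i : ℝ) - 1)⁻¹ := inv_nonneg.2 (by linarith)
  calc _ ≤ ((k i : ℝ) - 1)⁻¹ * 1 := mul_le_mul_of_nonneg_left h5 h6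
    _ ≤ 1 / 2 := by linarith

/-- A product of eigenfunctions is an eigenfunction of the adjacency operator of the product. -/
lemma sum_adj_prod_le {f : ∀ i, V i → ℝ} (hf0 : ∀ i x, 0 < f i x) {l : ι → ℝ}
    (hf : ∀ i x, ∑ z ∈ (T i).neighborFinset x, f i z = l i * f i x) (u : ∀ i, V i)
    (Z : Finset (∀ i, V i)) (hZ : ∀ v ∈ Z, (cartesianProduct T).Adj u v) :
    ∑ v ∈ Z, ∏ i, f i (v i) ≤ (∑ i, l i) * ∏ i, f i (u i) := by
  have hnn : ∀ v : ∀ i, V i, 0 ≤ ∏ i, f i (v i) := fun v =>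
    Finset.prod_nonneg fun i _ => (hf0 i _).le
  have hinj : Set.InjOn (fun a : (i : ι) × V i => Function.update u a.1 a.2)
      (coordNeighbors T u) := by
    rintro ⟨i, a⟩ ha ⟨j, b⟩ hb h
    simp only [coordNeighbors, Finset.coe_sigma, Set.mem_sigma_iff, Finset.mem_coe,
      SimpleGraph.mem_neighborFinset] at ha hb
    dsimp only at h
    have hij : i = j := by
      by_contra hne
      have := congrFun h i
      rw [Function.update_self, Function.update_of_ne hne] at this
      exact ha.2.ne this.symm
    subst hij
    have := congrFun h i
    rw [Function.update_self, Function.update_self] at this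
    rw [this]
  calc ∑ v ∈ Z, ∏ i, f i (v i)
      ≤ ∑ v ∈ (coordNeighbors T u).image (fun a => Function.update u a.1 a.2),
          ∏ i, f i (v i) := by
        refine Finset.sum_le_sum_of_subset_of_nonneg (fun v hv => ?_) fun v _ _ => hnn v
        obtain ⟨a, ha, h⟩ := exists_coordNeighbor (hZ v hv)
        exact Finset.mem_image.2 ⟨a, ha, h⟩
    _ = ∑ a ∈ coordNeighbors T u, ∏ i, f i (Function.update u a.1 a.2 i) :=
        Finset.sum_image hinj
    _ = ∑ i, ∑ w ∈ (T i).neighborFinset (u i), ∏ j, f j (Function.update u i w j) :=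
        Finset.sum_sigma _ _ _
    _ = ∑ i, l i * ∏ i, f i (u i) := by
        refine Finset.sum_congr rfl fun i _ => ?_
        have : ∀ w, ∏ j, f j (Function.update u i w j) =
            f i w * ∏ j ∈ Finset.univ.erase i, f j (u j) := fun w => by
          rw [← Finset.mul_prod_erase _ _ (Finset.mem_univ i), Function.update_self]
          congr 1
          exact Finset.prod_congr rfl fun j hj => by
            rw [Function.update_of_ne (Finset.ne_of_mem_erase hj)]
        rw [Finset.sum_congr rfl fun w _ => this w, ← Finset.sum_mul, hf, mul_assoc,
          Finset.mul_prod_erase _ (fun j => f j (u j)) (Finset.mem_univ i)]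
    _ = _ := (Finset.sum_mul _ _ _).symm

/-- In the subcritical regime, the two-point function is bounded on the product of the spherical
functions. -/
lemma sum_tau_mul_prod_le (hk : ∀ i, 3 ≤ k i) (hT : ∀ i, (T i).IsTree)
    (hreg : ∀ i, (T i).IsRegularOfDegree (k i)) {f : ∀ i, V i → ℝ} (hf0 : ∀ i x, 0 < f i x)
    (hf : ∀ i x, ∑ z ∈ (T i).neighborFinset x, f i z = 2 * √((k i : ℝ) - 1) * f i x)
    {o : ∀ i, V i} {q : ℝ} (hq0 : 0 ≤ q) (hq1 : q ≤ 1)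
    (h : Subcritical (cartesianProduct T) o q) {F : Finset (Sym2 (∀ i, V i))}
    (hF : (F : Set (Sym2 (∀ i, V i))) ⊆ (cartesianProduct T).edgeSet) (x : ∀ i, V i)
    (Z : Finset (∀ i, V i)) :
    ∑ y ∈ Z, tau F (fun _ => q) x y * ∏ i, f i (y i) ≤
      (∏ i, ((k i : ℝ) - 1) / (√((k i : ℝ) - 1) - 1) ^ 2) * ∏ i, f i (x i) := by
  have hterm : ∀ i (a b : V i), 0 ≤ (((k i : ℝ) - 1) ^ (T i).dist a b)⁻¹ * f i b := fun i a b => by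
    have := one_lt_degree_sub_one hk i
    have := hf0 i b
    positivity
  calc ∑ y ∈ Z, tau F (fun _ => q) x y * ∏ i, f i (y i)
      ≤ ∑ y ∈ Z, ∏ i, ((((k i : ℝ) - 1) ^ (T i).dist (x i) (y i))⁻¹ * f i (y i)) := by
        refine Finset.sum_le_sum fun y _ => ?_
        rw [Finset.prod_mul_distrib]
        exact mul_le_mul_of_nonneg_right (tau_le_of_subcritical hk hT hreg hq0 hq1 h hF x y)
          (Finset.prod_nonneg fun i _ => (hf0 i _).le)
    -- `Z` is enlarged to a box so that the sum factors over the coordinates.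
    _ ≤ ∑ y ∈ Fintype.piFinset fun i => Z.image fun y => y i,
          ∏ i, ((((k i : ℝ) - 1) ^ (T i).dist (x i) (y i))⁻¹ * f i (y i)) := by
        refine Finset.sum_le_sum_of_subset_of_nonneg (fun y hy => ?_)
          fun y _ _ => Finset.prod_nonneg fun i _ => hterm i _ _
        exact Fintype.mem_piFinset.2 fun i => Finset.mem_image_of_mem _ hy
    _ = ∏ i, ∑ b ∈ Z.image fun y => y i, (((k i : ℝ) - 1) ^ (T i).dist (x i) b)⁻¹ * f i b :=
        (Finset.prod_univ_sum (fun i => Z.image fun y => y i)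
          fun i b => (((k i : ℝ) - 1) ^ (T i).dist (x i) b)⁻¹ * f i b).symm
    _ ≤ ∏ i, (((k i : ℝ) - 1) / (√((k i : ℝ) - 1) - 1) ^ 2 * f i (x i)) :=
        Finset.prod_le_prod (fun i _ => Finset.sum_nonneg fun b _ => hterm i _ _)
          fun i _ => sum_inv_pow_dist_le (hT i) (hk i) (hreg i) (hf0 i) (hf i) _ _
    _ = _ := Finset.prod_mul_distrib

/-- The quantitative lower bound for retention probabilities of uniqueness. -/
lemma le_of_unique [Nonempty ι] (hk : ∀ i, 3 ≤ k i) (hT : ∀ i, (T i).IsTree)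
    (hreg : ∀ i, (T i).IsRegularOfDegree (k i)) {o : ∀ i, V i} {q p : I}
    (h : Subcritical (cartesianProduct T) o q)
    (hp : ∀ᵐ ω ∂(bondPercolation (cartesianProduct T) p),
      HasUniqueInfiniteCluster (cartesianProduct T) ω) :
    (q : ℝ) + (1 - q) / (2 * ∑ i, √((k i : ℝ) - 1)) *
      ∏ i, (√((k i : ℝ) - 1) - 1) ^ 2 / ((k i : ℝ) - 1) ≤ p := by
  choose f hf0 hf using fun i =>
    exists_eigenfunction (hT i) (by have := hk i; omega : 2 ≤ k i) (hreg i)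
  have hsqrt : ∀ i, 1 < √((k i : ℝ) - 1) := fun i =>
    Real.lt_sqrt_of_sq_lt (by linarith [one_lt_degree_sub_one hk i])
  set α : ℝ := ∑ i, 2 * √((k i : ℝ) - 1) with hα
  set C : ℝ := ∏ i, ((k i : ℝ) - 1) / (√((k i : ℝ) - 1) - 1) ^ 2 with hC
  have hα0 : 0 < α := Finset.sum_pos (fun i _ => by linarith [hsqrt i]) Finset.univ_nonempty
  have hC0 : 0 < C := Finset.prod_pos fun i _ => div_pos
    (by linarith [one_lt_degree_sub_one hk i]) (pow_pos (by linarith [hsqrt i]) 2)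
  have hCinv : ∏ i, (√((k i : ℝ) - 1) - 1) ^ 2 / ((k i : ℝ) - 1) = C⁻¹ := by
    rw [hC, ← Finset.prod_inv_distrib]
    exact Finset.prod_congr rfl fun i _ => (inv_div _ _).symm
  rw [hCinv, Finset.mul_sum, ← hα]
  by_contra! hlt
  have hq1 := le_half_of_subcritical hk hT hreg q.2.1 q.2.2 h
  -- Passing to max p q meets the requirement that the parameter increase. If p ≤ q the increment is
  -- zero and the bound only needs q < 1; otherwise it is the negated conclusion.
  have hbound : ((max p q : I) - (q : ℝ)) * (α * C) < 1 - q := by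
    rcases le_total p q with hpq | hpq
    · rw [max_eq_right hpq]; linarith
    · rw [max_eq_left hpq]
      rw [div_mul_eq_mul_div, ← div_eq_mul_inv, div_div, mul_comm C, ← sub_lt_iff_lt_add',
        lt_div_iff₀ (by positivity)] at hlt
      exact hlt
  have hqm : (q : ℝ) ≤ (max p q : I) := le_max_right p q
  have hpm : (p : ℝ) ≤ (max p q : I) := le_max_left p q
  obtain ⟨M, hM⟩ := sum_tau_le_of_lt (G := cartesianProduct T) q.2.1 hqm
    (max p q).2.2 (f := fun x => ∏ i, f i (x i)) (fun x => Finset.prod_pos fun i _ => hf0 i _)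
    hα0.le (sum_adj_prod_le hf0 hf)
    (fun F hF x Z => sum_tau_mul_prod_le hk hT hreg hf0 hf q.2.1 q.2.2 h hF x Z) hbound
  have : ∀ i, Countable (V i) := fun i => countable_of_isTree (hT i)
  have : ∀ i, Infinite (V i) := fun i => infinite_of_isTree (hT i) (hk i) (hreg i)
  have : ∀ i, Nonempty (V i) := fun i => inferInstance
  have : Infinite (∀ i, V i) := inferInstance
  have hpp : IsProb (fun _ : Sym2 (∀ i, V i) => (p : ℝ)) := isProb_const p.2.1 p.2.2
  have hpm' : IsProb (fun _ : Sym2 (∀ i, V i) => ((max p q : I) : ℝ)) :=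
    isProb_const (max p q).2.1 (max p q).2.2
  refine not_unique_of_sum_tau_le (cartesianProduct T) (exists_iso_apply_eq hk hT hreg) (M := M)
    (fun F hF W => ?_) hp
  refine le_trans (Finset.sum_le_sum fun x _ => Finset.sum_le_sum fun y _ =>
    tau_mono_prob hpp hpm' (fun _ => hpm) x y) ?_
  exact sum_sum_tau_le hpm' (f := fun x => ∏ i, f i (x i))
    (fun x => Finset.prod_pos fun i _ => hf0 i _) W fun x _ => hM F hF x W

/-- Failure of subcriticality at q gives percolation only strictly above q, hence the intermediate
parameter below p_c. -/
lemma subcritical_of_lt_pc (hT : ∀ i, (T i).IsTree) {o : ∀ i, V i} {q : I}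
    (h : q < pc (cartesianProduct T)) : Subcritical (cartesianProduct T) o q := by
  have : ∀ i, Countable (V i) := fun i => countable_of_isTree (hT i)
  by_contra hc
  obtain ⟨p, hqp, hp⟩ := exists_between h
  exact absurd (pc_le_of_not_subcritical (cartesianProduct T) hc hqp) (not_le.2 hp)

/-- The constant in the main theorem is at most one. -/
lemma gap_constant_le_one [Nonempty ι] (hk : ∀ i, 3 ≤ k i) :
    0 < (1 : ℝ) / (2 * ∑ i, √((k i : ℝ) - 1)) *
      ∏ i, (√((k i : ℝ) - 1) - 1) ^ 2 / ((k i : ℝ) - 1) ∧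
    (1 : ℝ) / (2 * ∑ i, √((k i : ℝ) - 1)) *
      ∏ i, (√((k i : ℝ) - 1) - 1) ^ 2 / ((k i : ℝ) - 1) ≤ 1 := by
  have hsqrt : ∀ i, 1 < √((k i : ℝ) - 1) := fun i =>
    Real.lt_sqrt_of_sq_lt (by linarith [one_lt_degree_sub_one hk i])
  have hsum : 1 < ∑ i, √((k i : ℝ) - 1) := by
    obtain ⟨i⟩ := ‹Nonempty ι›
    exact (hsqrt i).trans_le (Finset.single_le_sum (f := fun i => √((k i : ℝ) - 1))
      (fun j _ => Real.sqrt_nonneg _) (Finset.mem_univ i))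
  have hprod0 : 0 < ∏ i, (√((k i : ℝ) - 1) - 1) ^ 2 / ((k i : ℝ) - 1) :=
    Finset.prod_pos fun i _ => div_pos (pow_pos (by linarith [hsqrt i]) 2)
      (by linarith [one_lt_degree_sub_one hk i])
  have hprod1 : ∏ i, (√((k i : ℝ) - 1) - 1) ^ 2 / ((k i : ℝ) - 1) ≤ 1 := by
    refine Finset.prod_le_one (fun i _ => ?_) fun i _ => ?_
    · exact div_nonneg (sq_nonneg _) (by linarith [one_lt_degree_sub_one hk i])
    · have h1 := one_lt_degree_sub_one hk i
      have h2 := Real.sq_sqrt (show (0 : ℝ) ≤ (k i : ℝ) - 1 by linarith)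
      rw [div_le_one (by linarith)]
      nlinarith [hsqrt i]
  have h1 : (1 : ℝ) / (2 * ∑ i, √((k i : ℝ) - 1)) ≤ 1 := by
    rw [div_le_one (by linarith)]; linarith
  have h0 : (0 : ℝ) < 1 / (2 * ∑ i, √((k i : ℝ) - 1)) := by
    apply div_pos <;> linarith
  exact ⟨mul_pos h0 hprod0, mul_le_one₀ h1 hprod0.le hprod1⟩

end Product

end Percolation

/-! ### The main theorem -/

theorem theorem1p1 {N : ℕ} (hN : 1 ≤ N) {V : Fin N → Type*} (T : ∀ i, SimpleGraph (V i))
    [∀ i, (T i).LocallyFinite] (k : Fin N → ℕ) (hk : ∀ i, 3 ≤ k i)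
    (hT : ∀ i, (T i).IsTree) (hreg : ∀ i, (T i).IsRegularOfDegree (k i)) :
    Percolation.pc (Percolation.cartesianProduct T) <
        Percolation.pu (Percolation.cartesianProduct T) ∧
      (1 - (Percolation.pc (Percolation.cartesianProduct T) : ℝ)) /
            (2 * ∑ i, √((k i : ℝ) - 1)) *
          ∏ i, (√((k i : ℝ) - 1) - 1) ^ 2 / ((k i : ℝ) - 1) ≤
        (Percolation.pu (Percolation.cartesianProduct T) : ℝ) -
          (Percolation.pc (Percolation.cartesianProduct T) : ℝ) := by
  open Percolation in
  have hne : Nonempty (Fin N) := ⟨⟨0, hN⟩⟩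
  set G := cartesianProduct T with hG
  obtain ⟨a0, a1⟩ := gap_constant_le_one hk
  set a : ℝ := (1 : ℝ) / (2 * ∑ i, √((k i : ℝ) - 1)) *
      ∏ i, (√((k i : ℝ) - 1) - 1) ^ 2 / ((k i : ℝ) - 1) with ha
  have hrw : ∀ t : ℝ, (1 - t) / (2 * ∑ i, √((k i : ℝ) - 1)) *
      ∏ i, (√((k i : ℝ) - 1) - 1) ^ 2 / ((k i : ℝ) - 1) = (1 - t) * a := fun t => by
    rw [ha]; ring
  have o : ∀ i, V i := fun i => (hT i).connected.nonempty.some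
  have hpu : ∀ q : I, Subcritical G o q → (q : ℝ) + (1 - q) * a ≤ pu G := by
    intro q hq
    -- A convex combination of q and 1, hence a point of the unit interval and a lower bound there
    -- for the uniqueness parameters. This holds even if there were none, when the infimum is 1.
    have hmem : (q : ℝ) + (1 - q) * a ∈ I := by
      have h0 := q.2.1
      have h1 := q.2.2
      constructor <;> nlinarith
    have : (⟨_, hmem⟩ : I) ≤ pu G := le_sInf fun p hp => by
      have := le_of_unique hk hT hreg hq hp
      rw [hrw] at this
      exact this
    exact this
  -- Makes 1 - p_c positive, so that the quantitative gap implies the strict inequality.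
  have hpc : (pc G : ℝ) ≤ 1 / 2 := by
    by_contra! h
    let half : I := ⟨1 / 2, by norm_num, by norm_num⟩
    obtain ⟨q, h1, h2⟩ := exists_between (show half < pc G from h)
    have h3 := le_half_of_subcritical hk hT hreg q.2.1 q.2.2 (subcritical_of_lt_pc (o := o) hT h2)
    have h4 : (1 / 2 : ℝ) < q := h1
    linarith
  have hgap : (1 - (pc G : ℝ)) * a ≤ (pu G : ℝ) - (pc G : ℝ) := by
    by_contra! h
    set ε := (1 - (pc G : ℝ)) * a - ((pu G : ℝ) - (pc G : ℝ)) with hε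
    have hε0 : 0 < ε := by linarith
    have hpc0 : (0 : ℝ) ≤ pc G := (pc G).2.1
    -- As t ↦ t + (1 - t) a has slope 1 - a in [0, 1], replacing p_c by `q` loses at most ε / 2,
    -- less than the assumed defect ε. The truncation at 0 is handled by `subcritical_zero` when p_c
    -- = 0.
    let q : I := ⟨max 0 ((pc G : ℝ) - ε / 2), le_max_left _ _, max_le zero_le_one (by linarith)⟩
    have hq1 : (pc G : ℝ) - ε / 2 ≤ q := le_max_right _ _
    have hsub : Subcritical G o q := by
      rcases hpc0.eq_or_lt with h0 | h0
      · have : (q : ℝ) = 0 := max_eq_left (by linarith)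
        rw [this]
        exact subcritical_zero G o
      · exact subcritical_of_lt_pc hT (show (q : ℝ) < pc G from max_lt h0 (by linarith))
    have := hpu q hsub
    nlinarith
  rw [hrw]
  refine ⟨?_, hgap⟩
  have : (0 : ℝ) < (1 - (pc G : ℝ)) * a := mul_pos (by linarith) a0
  exact show (pc G : ℝ) < pu G by linarith
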